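/- Let $p$ be a prime, and let "graded commutative algebra" mean a $\mathbb Z$-graded $\mathbb F_p$-algebra with $ab=(-1)^{|a||b|}ba$ for homogeneous $a,b$. Put $d=1$ if $p=2$ and $d=2$ if $p$ is odd. **The dual Steenrod algebra.** $\mathcal A_{2*}=\mathbb F_2[\xi_1,\xi_2,\dots]$, and $\mathcal A_{p*}=E(\tau_0,\tau_1,\dots)\otimes\mathbb F_p[\xi_1,\xi_2,\dots]$ for odd $p$, with $\deg\xi_n=d(p^n-1)$, $\deg\tau_n=2p^n-1$, $\xi_0=1$, is the Hopf algebra with coproduct $\mu(\xi_n)=\sum_{k=0}^n\xi_{n-k}^{p^k}\otimes\xi_k$, $\mu(\tau_n)=\sum_{k=0}^n\xi_{n-k}^{p^k}\otimes\tau_k+\tau_n\otimes1$, and conjugation given by $\sum_{k=0}^n\xi_{n-k}^{p^k}\iota(\xi_k)=0$ $(n\ge1)$, $\iota(\tau_n)=-\sum_{k=0}^n\iota(\xi_{n-k})^{p^k}\tau_k$. **The group schemes.** Let $A_*$ be a graded commutative algebra and $\deg\epsilon=-1$. For $k\ge0$ let $G_p^{\langle k\rangle}(A_*)$ be the set of power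 series $\alpha(X)=\sum_{i\ge0}\alpha_iX^{p^i}$ over $A_*[\epsilon]/(\epsilon^2)$ with $\deg\alpha_i=d(p^{i+k}-p^k)$ and $\alpha_0-1\in(\epsilon)$, such that moreover: all $\alpha_i\in A_*$ if $p=2$ or $k\ge2$; $\alpha_i\in A_*$ for $i\ge1$ if $p$ is odd and $k=1$. It is a group under $\alpha\cdot\beta=\beta(\alpha(X))$, where for odd $p$ and $k=1$ one afterwards sets $\epsilon=0$ in the coefficients of $X^{p^i}$, $i\ge1$. Put $G_p=G_p^{\langle0\rangle}$; homomorphisms $\varphi:\mathcal A_{p*}\to A_*$ correspond to elements of $G_p(A_*)$ by $\varphi\mapsto X+\sum_{i\ge1}\varphi(\xi_i)X^{2^i}$ for $p=2$ and $\varphi\mapsto\sum_{i\ge0}(\varphi(\xi_i)+\varphi(\tau_i)\epsilon)X^{p^i}$ for odd $p$. Let $\rho_0:G_p\to G_p^{\langle1\rangle}$, $\rho_0(\alpha)=\alpha_0X+\sum_{i\ge1}\alpha_i^pX^{p^i}$, and $\rho_k:G_p^{\langle k\rangle}\to G_p^{\langle k+1\rangle}$, $\rho_k(\alpha)=X+\sum_{i\ge1}\alpha_i^pX^{p^i}$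 for $k\ge1$. Put $G_p^{ab}=\ker\rho_0$ and $G_p^{[k]}=\ker\rho_k$ for $k\ge1$. **The ideals.** Let $\mathcal A_p\langle0\rangle_*=\mathcal A_{p*}$ and, for $k\ge1$, let $\mathcal A_p\langle k\rangle_*\subset\mathcal A_{p*}$ be the subalgebra generated by all $\xi_n^{p^k}$, $n\ge1$, and also by $\tau_0$ if $p$ is odd and $k=1$. Let $I_p^{\langle k\rangle}$ be the ideal of $\mathcal A_p\langle k\rangle_*$ generated by all $\xi_n^{p^{k+1}}$, $n\ge1$, and also by $\tau_0$ if $p$ is odd and $k=0$. Let $J_p^{\langle k\rangle}$ be the ideal of $\mathcal A_{p*}$ generated by $I_p^{\langle k\rangle}$. **Proposition.** Each $J_p^{\langle k\rangle}$ $(k\ge0)$ is a Hopf ideal of $\mathcal A_{p*}$. The closed subschemes $\tilde G_p^{\langle k\rangle}$ of $G_p$ defined by $J_p^{\langle k\rangle}$ (the elements of $G_p(A_*)$ that correspond to homomorphisms $\mathcal A_{p*}\to A_*$ vanishing on $J_p^{\langle k\rangle}$) are normal subgroup schemes and form an increasing sequence $$G_p^{ab}=\tilde G_p^{\langle0\rangle}\subset\tilde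 G_p^{\langle1\rangle}\subset\cdots\subset\tilde G_p^{\langle k\rangle}\subset\tilde G_p^{\langle k+1\rangle}\subset\cdots\subset G_p ,$$ and for every $k\ge1$ the quotient $\tilde G_p^{\langle k\rangle}/\tilde G_p^{\langle k-1\rangle}$ is isomorphic to $G_p^{[k]}$; that is, $G_p^{[k]}$ is an affine group scheme and there is a homomorphism of group schemes $\tilde G_p^{\langle k\rangle}\to G_p^{[k]}$ with kernel $\tilde G_p^{\langle k-1\rangle}$ which is surjective for the faithfully flat topology (every element of $G_p^{[k]}(A_*)$ lifts to $\tilde G_p^{\langle k\rangle}(B_*)$ for some faithfully flat $A_*\to B_*$). -/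

import Mathlib

universe u v

namespace Steenrod

open CategoryTheory TensorProduct DirectSum

/-- A graded commutative algebra over `𝔽_p`: a `ℤ`-graded `𝔽_p`-algebra in which
`a b = (-1)^{|a| |b|} b a` for homogeneous elements `a`, `b`. -/
structure GrAlg (p : ℕ) where
  carrier : Type u
  [ring : Ring carrier]
  [algebra : Algebra (ZMod p) carrier]
  deg : ℤ → Submodule (ZMod p) carrier
  [graded : GradedAlgebra deg]
  comm : ∀ {i j : ℤ} {a b : carrier}, a ∈ deg i → b ∈ deg j →
    a * b = (i * j).negOnePow • (b * a)

attribute [instance] GrAlg.ring GrAlg.algebra GrAlg.graded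

namespace GrAlg

variable {p : ℕ}

instance : CoeSort (GrAlg.{u} p) (Type u) := ⟨GrAlg.carrier⟩

/-- Homomorphisms of graded commutative algebras: degree-preserving algebra homomorphisms. -/
@[ext]
structure Hom (A B : GrAlg.{u} p) where
  toAlgHom : A →ₐ[ZMod p] B
  map_deg : ∀ {i : ℤ} {a : A}, a ∈ A.deg i → toAlgHom a ∈ B.deg i

instance : Category (GrAlg.{u} p) where
  Hom := Hom
  id A := ⟨AlgHom.id _ _, fun h => h⟩
  comp f g := ⟨g.toAlgHom.comp f.toAlgHom, fun h => g.map_deg (f.map_deg h)⟩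

@[simp] lemma id_toAlgHom (A : GrAlg.{u} p) : Hom.toAlgHom (𝟙 A) = AlgHom.id _ _ := rfl

@[simp] lemma comp_toAlgHom {A B C : GrAlg.{u} p} (f : A ⟶ B) (g : B ⟶ C) :
    Hom.toAlgHom (f ≫ g) = (Hom.toAlgHom g).comp (Hom.toAlgHom f) := rfl

lemma sgn_aux (A : GrAlg.{u} p) {i j : ℤ} (x : A.deg i) (y : A.deg j) :
    (((i + j).negOnePow : ℤˣ) : ℤ) • ((x : A) * (y : A)) =
      ((i.negOnePow : ℤˣ) : ℤ) • (x : A) * ((j.negOnePow : ℤˣ) : ℤ) • (y : A) := by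
  rw [Int.negOnePow_add, Units.val_mul, smul_mul_assoc, mul_smul_comm, mul_smul]

/-- The grade involution `a ↦ (-1)^{|a|} a`. -/
noncomputable def sgn (A : GrAlg.{u} p) : A →ₐ[ZMod p] A :=
  (DirectSum.toAlgebra (ZMod p) (fun i => A.deg i)
    (fun i => ((i.negOnePow : ℤˣ) : ℤ) • (A.deg i).subtype)
    (by simp) (fun {_ _} x y => A.sgn_aux x y)).comp (decomposeAlgEquiv A.deg).toAlgHom

lemma sgn_of_mem (A : GrAlg.{u} p) {i : ℤ} {a : A} (h : a ∈ A.deg i) :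
    A.sgn a = i.negOnePow • a := by
  have h1 : A.sgn a = DirectSum.toModule (ZMod p) ℤ A
    (fun i => ((i.negOnePow : ℤˣ) : ℤ) • (A.deg i).subtype) (decompose A.deg a) := rfl
  rw [h1, decompose_of_mem _ h]
  erw [DirectSum.toModule_lof]
  rfl

lemma hom_sgn {A B : GrAlg.{u} p} (f : A ⟶ B) (a : A) :
    f.toAlgHom (A.sgn a) = B.sgn (f.toAlgHom a) := by
  refine Decomposition.inductionOn A.deg (by simp) (fun {i} m => ?_) (fun m n h h' => ?_) a
  · rw [sgn_of_mem _ m.2, sgn_of_mem _ (f.map_deg m.2), Units.smul_def, Units.smul_def, map_zsmul]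
  · simp [h, h']

/-- `d = 1` for `p = 2` and `d = 2` for odd `p`; `-d` is the degree of the variable `X`. -/
def unitDeg (p : ℕ) : ℤ := if p = 2 then 1 else 2

lemma natCast_eq_zero (A : GrAlg.{u} p) : (p : A) = 0 := by
  rw [← map_natCast (algebraMap (ZMod p) A), ZMod.natCast_self, map_zero]

lemma negOnePow_smul {M : Type*} [AddCommGroup M] [Module (ZMod p) M] {i : ℤ}
    (h : unitDeg p ∣ i) (a : M) : i.negOnePow • a = a := by
  by_cases hp : p = 2
  · subst hp
    rcases Int.even_or_odd i with hi | hi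
    · rw [Int.negOnePow_even _ hi, one_smul]
    · rw [Int.negOnePow_odd _ hi, Units.neg_smul, one_smul]
      have h : (2 : ZMod 2) • a = 0 := by
        rw [show (2 : ZMod 2) = 0 from rfl, zero_smul]
      rw [two_smul] at h
      exact neg_eq_of_add_eq_zero_left h
  · rw [unitDeg, if_neg hp] at h
    rw [Int.negOnePow_even _ (even_iff_two_dvd.2 h), one_smul]

lemma commute_of_dvd (A : GrAlg.{u} p) {i j : ℤ} {a b : A} (h : unitDeg p ∣ i)
    (ha : a ∈ A.deg i) (hb : b ∈ A.deg j) : Commute a b := by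
  rw [Commute, SemiconjBy, A.comm ha hb, negOnePow_smul (h.mul_right j)]

lemma sgn_of_dvd (A : GrAlg.{u} p) {i : ℤ} {a : A} (h : unitDeg p ∣ i) (ha : a ∈ A.deg i) :
    A.sgn a = a := by
  rw [sgn_of_mem _ ha, negOnePow_smul h]

end GrAlg

/-- The algebra `A[ε]/(ε²)`, `|ε| = -1`, with elements `re + im ε`; the sign rule is
`ε c = (-1)^{|c|} c ε`. -/
@[ext]
structure Eps {p : ℕ} (A : GrAlg.{u} p) where
  re : A
  im : A

namespace Eps

variable {p : ℕ} {A B : GrAlg.{u} p}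

instance : Zero (Eps A) := ⟨⟨0, 0⟩⟩
instance : One (Eps A) := ⟨⟨1, 0⟩⟩
instance : Add (Eps A) := ⟨fun x y => ⟨x.re + y.re, x.im + y.im⟩⟩
instance : Neg (Eps A) := ⟨fun x => ⟨-x.re, -x.im⟩⟩
noncomputable instance : Mul (Eps A) := ⟨fun x y => ⟨x.re * y.re, x.re * y.im + x.im * A.sgn y.re⟩⟩

@[simp] lemma re_zero : (0 : Eps A).re = 0 := rfl
@[simp] lemma im_zero : (0 : Eps A).im = 0 := rfl
@[simp] lemma re_one : (1 : Eps A).re = 1 := rfl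
@[simp] lemma im_one : (1 : Eps A).im = 0 := rfl
@[simp] lemma re_add (x y : Eps A) : (x + y).re = x.re + y.re := rfl
@[simp] lemma im_add (x y : Eps A) : (x + y).im = x.im + y.im := rfl
@[simp] lemma re_neg (x : Eps A) : (-x).re = -x.re := rfl
@[simp] lemma im_neg (x : Eps A) : (-x).im = -x.im := rfl
@[simp] lemma re_mul (x y : Eps A) : (x * y).re = x.re * y.re := rfl
@[simp] lemma im_mul (x y : Eps A) : (x * y).im = x.re * y.im + x.im * A.sgn y.re := rfl

noncomputable instance : Ring (Eps A) where
  add_assoc x y z := by ext <;> simp [add_assoc]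
  zero_add x := by ext <;> simp
  add_zero x := by ext <;> simp
  add_comm x y := by ext <;> simp [add_comm]
  neg_add_cancel x := by ext <;> simp
  mul_assoc x y z := by ext <;> simp [mul_assoc, mul_add, add_mul, add_assoc]
  one_mul x := by ext <;> simp
  mul_one x := by ext <;> simp
  zero_mul x := by ext <;> simp
  mul_zero x := by ext <;> simp
  left_distrib x y z := by ext <;> simp [mul_add, add_assoc, add_left_comm]
  right_distrib x y z := by ext <;> simp [add_mul, add_assoc, add_left_comm]
  nsmul := nsmulRec
  zsmul := zsmulRec

/-- The projection `A[ε]/(ε²) → A[ε]/(ε) = A`. -/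
noncomputable def reHom : Eps A →+* A where
  toFun := re
  map_zero' := rfl
  map_one' := rfl
  map_add' _ _ := rfl
  map_mul' _ _ := rfl

/-- The coefficient of `ε`. -/
noncomputable def imHom : Eps A →+ A where
  toFun := im
  map_zero' := rfl
  map_add' _ _ := rfl

@[simp] lemma reHom_apply (x : Eps A) : reHom x = x.re := rfl
@[simp] lemma imHom_apply (x : Eps A) : imHom x = x.im := rfl

lemma natCast_eq_zero : (p : Eps A) = 0 := by
  have h : ∀ n : ℕ, (n : Eps A) = ⟨n, 0⟩ := by
    intro n
    induction n with
    | zero => ext <;> simp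
    | succ n ih => ext <;> simp [ih]
  rw [h, GrAlg.natCast_eq_zero]
  rfl

@[simp] lemma re_pow (x : Eps A) (n : ℕ) : (x ^ n).re = x.re ^ n := map_pow reHom x n

/-- The elements of degree `n` of `A[ε]/(ε²)`. -/
def HasDeg (x : Eps A) (n : ℤ) : Prop := x.re ∈ A.deg n ∧ x.im ∈ A.deg (n + 1)

/-- The homomorphism `A[ε]/(ε²) → B[ε]/(ε²)` induced by `A → B`. -/
noncomputable def map (f : A ⟶ B) : Eps A →+* Eps B where
  toFun x := ⟨f.toAlgHom x.re, f.toAlgHom x.im⟩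
  map_zero' := by ext <;> simp
  map_one' := by ext <;> simp
  map_add' _ _ := by ext <;> simp
  map_mul' _ _ := by ext <;> simp [GrAlg.hom_sgn]

@[simp] lemma re_map (f : A ⟶ B) (x : Eps A) : (map f x).re = f.toAlgHom x.re := rfl
@[simp] lemma im_map (f : A ⟶ B) (x : Eps A) : (map f x).im = f.toAlgHom x.im := rfl

end Eps

section PowerSeriesComposition

open PowerSeries

variable {p : ℕ} {R : Type u} [Ring R]

/-- The composite `β(α(X)) = ∑ i, βᵢ α(X)^i` of power series, for `α` without constant term. -/
noncomputable def comp (α β : R⟦X⟧) : R⟦X⟧ :=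
  PowerSeries.mk fun n => ∑ i ∈ Finset.range (n + 1), coeff i β * coeff n (α ^ i)

lemma add_pow_of_commute [Fact p.Prime] (hR : (p : R) = 0) {x y : R} (h : Commute x y) (j : ℕ) :
    (x + y) ^ p ^ j = x ^ p ^ j + y ^ p ^ j := by
  rcases subsingleton_or_nontrivial R with h0 | h0
  · exact Subsingleton.elim _ _
  · have : CharP R p := (CharP.charP_iff_prime_eq_zero Fact.out).2 hR
    exact add_pow_char_pow_of_commute _ _ h

lemma sum_pow_of_commute [Fact p.Prime] (hR : (p : R) = 0) {ι : Type*} (s : Finset ι) (f : ι → R)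
    (h : ∀ a ∈ s, ∀ b ∈ s, Commute (f a) (f b)) (j : ℕ) :
    (∑ a ∈ s, f a) ^ p ^ j = ∑ a ∈ s, f a ^ p ^ j := by
  classical
  induction s using Finset.induction_on with
  | empty => simp [(Fact.out : p.Prime).ne_zero]
  | insert a s ha ih =>
    rw [Finset.sum_insert ha, Finset.sum_insert ha, add_pow_of_commute hR, ih]
    · exact fun b hb c hc => h b (Finset.mem_insert_of_mem hb) c (Finset.mem_insert_of_mem hc)
    · exact Commute.sum_right _ _ _ fun b hb =>
        h a (Finset.mem_insert_self _ _) b (Finset.mem_insert_of_mem hb)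

lemma coeff_pow_comm [Fact p.Prime] {S : Type u} [CommRing S] (hS : (p : S) = 0)
    (α : S⟦X⟧) (j n : ℕ) :
    coeff n (α ^ p ^ j) = if p ^ j ∣ n then (coeff (n / p ^ j) α) ^ p ^ j else 0 := by
  have hp : p.Prime := Fact.out
  rcases subsingleton_or_nontrivial S with h0 | h0
  · exact Subsingleton.elim _ _
  have : CharP S p := (CharP.charP_iff_prime_eq_zero hp).2 hS
  induction j generalizing n with
  | zero => simp
  | succ j ih =>
    have h1 : α ^ p ^ (j + 1) =
        PowerSeries.map (frobenius S p) (PowerSeries.expand p hp.ne_zero (α ^ p ^ j)) := by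
      rw [pow_succ, pow_mul]
      exact (MvPowerSeries.map_frobenius_expand p hp.ne_zero).symm
    rw [h1, coeff_map, coeff_expand]
    by_cases hd : p ∣ n
    · obtain ⟨m, rfl⟩ := hd
      rw [if_pos (dvd_mul_right _ _), Nat.mul_div_cancel_left _ hp.pos, ih, pow_succ',
        Nat.mul_div_mul_left _ _ hp.pos]
      simp only [Nat.mul_dvd_mul_iff_left hp.pos]
      split_ifs
      · rw [frobenius_def, ← pow_mul, mul_comm]
      · simp
    · rw [if_neg hd, if_neg (fun h => hd ((dvd_pow_self p (Nat.succ_ne_zero j)).trans h)), map_zero]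

lemma coeff_pow_of_commute [Fact p.Prime] (hR : (p : R) = 0) (α : R⟦X⟧)
    (hα : ∀ m n, Commute (coeff m α) (coeff n α)) (j n : ℕ) :
    coeff n (α ^ p ^ j) = if p ^ j ∣ n then (coeff (n / p ^ j) α) ^ p ^ j else 0 := by
  let s : Set R := Set.range fun n => coeff n α
  have hc : IsMulCommutative (Subring.closure s) := Subring.isMulCommutative_closure (by
    rintro _ ⟨m, rfl⟩ _ ⟨n, rfl⟩
    exact hα m n)
  let _ : CommRing (Subring.closure s) :=
    { (inferInstance : Ring (Subring.closure s)) with mul_comm := hc.is_comm.comm }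
  let β : (Subring.closure s)⟦X⟧ :=
    PowerSeries.mk fun n => ⟨coeff n α, Subring.subset_closure ⟨n, rfl⟩⟩
  have hβ : PowerSeries.map (Subring.closure s).subtype β = α := by
    ext n
    simp [β]
  have hS : (p : Subring.closure s) = 0 := Subtype.ext (by simpa using hR)
  rw [← hβ, ← map_pow, coeff_map, coeff_map]
  have h := coeff_pow_comm (S := Subring.closure s) hS β j n
  refine (congrArg _ h).trans ?_
  split_ifs
  · exact map_pow _ _ _
  · exact map_zero _

variable [Fact p.Prime]

lemma coeff_comp_eq_zero (hR : (p : R) = 0) {α β : R⟦X⟧}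
    (hα : ∀ m n, Commute (coeff m α) (coeff n α))
    (sα : ∀ n, (∀ i, n ≠ p ^ i) → coeff n α = 0) (sβ : ∀ n, (∀ i, n ≠ p ^ i) → coeff n β = 0)
    (n : ℕ) (hn : ∀ i, n ≠ p ^ i) : coeff n (comp α β) = 0 := by
  rw [comp, coeff_mk]
  refine Finset.sum_eq_zero fun m _ => ?_
  by_cases hm : ∃ j, m = p ^ j
  · obtain ⟨j, rfl⟩ := hm
    rw [coeff_pow_of_commute hR α hα]
    split_ifs with hd
    · obtain ⟨l, rfl⟩ := hd
      rw [Nat.mul_div_cancel_left _ (pow_pos (Fact.out : p.Prime).pos j), sα l, zero_pow, mul_zero]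
      · exact pow_ne_zero _ (Fact.out : p.Prime).ne_zero
      · rintro i rfl
        exact hn (j + i) (pow_add _ _ _).symm
    · rw [mul_zero]
  · rw [sβ m (fun j h => hm ⟨j, h⟩), zero_mul]

lemma coeff_comp (hR : (p : R) = 0) {α β : R⟦X⟧}
    (hα : ∀ m n, Commute (coeff m α) (coeff n α))
    (sβ : ∀ n, (∀ i, n ≠ p ^ i) → coeff n β = 0) (n : ℕ) :
    coeff (p ^ n) (comp α β) =
      ∑ ij ∈ Finset.HasAntidiagonal.antidiagonal n, coeff (p ^ ij.2) β * coeff (p ^ ij.1) α ^ p ^ ij.2 := by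
  have hp : p.Prime := Fact.out
  rw [comp, coeff_mk]
  symm
  refine Finset.sum_of_injOn (fun ij : ℕ × ℕ => p ^ ij.2) ?_ ?_ ?_ ?_
  · rintro ⟨i, j⟩ h ⟨i', j'⟩ h' e
    have e1 : j = j' := Nat.pow_right_injective hp.two_le e
    simp only [Finset.mem_coe,
      Finset.HasAntidiagonal.mem_antidiagonal] at h h'
    exact Prod.ext (by simp only; omega) e1
  · rintro ⟨i, j⟩ h
    simp only [Finset.mem_coe, Finset.HasAntidiagonal.mem_antidiagonal] at h
    simp only [Finset.coe_range, Set.mem_Iio]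
    exact Nat.lt_succ_of_le (Nat.pow_le_pow_right hp.pos (by omega))
  · intro m hm hm'
    by_cases h : ∃ j, m = p ^ j
    · obtain ⟨j, rfl⟩ := h
      rw [Finset.mem_range, Nat.lt_succ_iff, Nat.pow_le_pow_iff_right hp.one_lt] at hm
      exact absurd ⟨(n - j, j), by simpa using Nat.sub_add_cancel hm, rfl⟩ hm'
    · rw [sβ m (fun j h' => h ⟨j, h'⟩), zero_mul]
  · rintro ⟨i, j⟩ h
    rw [Finset.HasAntidiagonal.mem_antidiagonal] at h
    subst h
    simp only
    rw [coeff_pow_of_commute hR α hα, if_pos (pow_dvd_pow _ (by omega)), add_comm i j, pow_add,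
      Nat.mul_div_cancel_left _ (pow_pos hp.pos j)]

lemma sum_antidiagonal_assoc {M : Type*} [AddCommMonoid M] (n : ℕ) (f : ℕ → ℕ → ℕ → M) :
    ∑ mk ∈ Finset.HasAntidiagonal.antidiagonal n, ∑ ij ∈ Finset.HasAntidiagonal.antidiagonal mk.1, f ij.1 ij.2 mk.2 =
      ∑ il ∈ Finset.HasAntidiagonal.antidiagonal n, ∑ jk ∈ Finset.HasAntidiagonal.antidiagonal il.2, f il.1 jk.1 jk.2 := by
  rw [Finset.sum_sigma', Finset.sum_sigma']
  refine Finset.sum_nbij' (fun x => ⟨(x.2.1, x.2.2 + x.1.2), (x.2.2, x.1.2)⟩)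
    (fun x => ⟨(x.1.1 + x.2.1, x.2.2), (x.1.1, x.2.1)⟩) ?_ ?_ ?_ ?_ ?_ <;>
  · rintro ⟨⟨a, b⟩, c, d⟩ h
    simp only [Finset.mem_sigma, Finset.HasAntidiagonal.mem_antidiagonal] at h ⊢
    all_goals first
    | exact ⟨by omega, by omega⟩
    | (simp only [and_true]; omega)
    | (obtain ⟨rfl, rfl⟩ := h; rfl)

end PowerSeriesComposition

namespace Eps

variable {p : ℕ} {A : GrAlg.{u} p}

lemma commute_of_hasDeg {x y : Eps A} {i j : ℤ} (hx : x.HasDeg i) (hy : y.HasDeg j)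
    (hi : GrAlg.unitDeg p ∣ i) (hj : GrAlg.unitDeg p ∣ j) : Commute x y := by
  ext
  · exact (A.commute_of_dvd hi hx.1 hy.1).eq
  · simp only [im_mul, A.sgn_of_dvd hi hx.1, A.sgn_of_dvd hj hy.1]
    rw [(A.commute_of_dvd hi hx.1 hy.2).eq, (A.commute_of_dvd hj hy.1 hx.2).eq, add_comm]

lemma im_pow {x : Eps A} {i : ℤ} (hx : x.HasDeg i) (hi : GrAlg.unitDeg p ∣ i) (m : ℕ) :
    (x ^ (m + 1)).im = ((m + 1 : ℕ) : A) * (x.re ^ m * x.im) := by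
  induction m with
  | zero => simp
  | succ m ih =>
    rw [pow_succ x, im_mul, ih, re_pow, A.sgn_of_dvd hi hx.1, mul_assoc, mul_assoc,
      ← (A.commute_of_dvd hi hx.1 hx.2).eq, ← mul_assoc (x.re ^ m) x.re, ← pow_succ]
    push_cast
    noncomm_ring

lemma im_pow_p [Fact p.Prime] {x : Eps A} {i : ℤ} (hx : x.HasDeg i) (hi : GrAlg.unitDeg p ∣ i)
    (j : ℕ) : (x ^ p ^ (j + 1)).im = 0 := by
  obtain ⟨m, hm⟩ := Nat.exists_eq_succ_of_ne_zero
    (pow_ne_zero (j + 1) (Fact.out : p.Prime).ne_zero)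
  have h := im_pow hx hi m
  rw [← Nat.succ_eq_add_one, ← hm] at h
  rw [h, Nat.cast_pow, A.natCast_eq_zero, zero_pow (Nat.succ_ne_zero j), zero_mul]

end Eps

open PowerSeries

/-- `EpsAllowed p k i` says that the coefficient of `X^(p^i)` of an element of `G_p^⟨k⟩` may involve
`ε`: always for `k = 0`, for `k = 1` only if `i = 0`, and never if `p = 2` or `k ≥ 2`. -/
def EpsAllowed (p k i : ℕ) : Prop := p ≠ 2 ∧ (k = 0 ∨ (k = 1 ∧ i = 0))

/-- The degree of the coefficient of `X^(p^i)` of an element of `G_p^⟨k⟩`: it is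
`2^(i+k) - 2^k` for `p = 2` and `2 (p^(i+k) - p^k)` for odd `p`. -/
def coeffDeg (p k i : ℕ) : ℤ := GrAlg.unitDeg p * ((p : ℤ) ^ (i + k) - (p : ℤ) ^ k)

/-- Membership in `G_p^⟨k⟩(A)` for a power series over `A[ε]/(ε²)`: it is
`∑ i, αᵢ X^(p^i)` with `αᵢ` of degree `coeffDeg p k i`, with `α₀ - 1 ∈ (ε)`, and with `αᵢ ∈ A` whenever
`ε` is not allowed in `αᵢ`. -/
structure IsElem (p k : ℕ) (A : GrAlg.{u} p) (α : (Eps A)⟦X⟧) : Prop where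
  supp : ∀ n, (∀ i, n ≠ p ^ i) → coeff n α = 0
  deg : ∀ i, (coeff (p ^ i) α).HasDeg (coeffDeg p k i)
  lead : (coeff 1 α).re = 1
  eps : ∀ i, ¬ EpsAllowed p k i → (coeff (p ^ i) α).im = 0

/-- The set `G_p^⟨k⟩(A)`; for `k = 0` this is the mod `p` Steenrod group `G_p(A)`. -/
def Elem (p k : ℕ) (A : GrAlg.{u} p) : Type u := {α : (Eps A)⟦X⟧ // IsElem p k A α}

/-- The map `α₀ X + ∑ αᵢ X^(p^i) ↦ α₀ X + ∑ q(αᵢ) X^(p^i)`, where `q : A[ε]/(ε²) → A` is the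
projection. -/
noncomputable def qhat {p : ℕ} {A : GrAlg.{u} p} (α : (Eps A)⟦X⟧) : (Eps A)⟦X⟧ :=
  PowerSeries.mk fun n => if n = 1 then coeff n α else ⟨(coeff n α).re, 0⟩

/-- The product `α · β = β(α(X))` of `G_p^⟨k⟩`, followed by `qhat` if `p` is odd and `k = 1`. -/
noncomputable def prodSeries (p k : ℕ) {A : GrAlg.{u} p} (α β : (Eps A)⟦X⟧) : (Eps A)⟦X⟧ :=
  if p ≠ 2 ∧ k = 1 then qhat (comp α β) else comp α β

/-- The series `∑ i, cᵢ X^(p^i)`. -/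
noncomputable def ofSeq (p : ℕ) {R : Type u} [Ring R] (c : ℕ → R) : R⟦X⟧ :=
  PowerSeries.mk fun n => if n = p ^ Nat.log p n then c (Nat.log p n) else 0

namespace Elem

variable {p : ℕ} [hp : Fact p.Prime]

lemma coeff_ofSeq {R : Type u} [Ring R] (c : ℕ → R) (i : ℕ) :
    coeff (p ^ i) (ofSeq p c) = c i := by
  simp [ofSeq, Nat.log_pow hp.out.one_lt]

lemma coeff_ofSeq_ne {R : Type u} [Ring R] (c : ℕ → R) (n : ℕ) (h : ∀ i, n ≠ p ^ i) :
    coeff n (ofSeq p c) = 0 := by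
  rw [ofSeq, coeff_mk, if_neg (h _)]

variable {k : ℕ} {A B : GrAlg.{u} p}

/-- The coefficient of `X^(p^i)`. -/
noncomputable def c (α : Elem p k A) (i : ℕ) : Eps A := coeff (p ^ i) α.1

lemma dvd_coeffDeg (p k i : ℕ) : GrAlg.unitDeg p ∣ coeffDeg p k i := dvd_mul_right _ _

lemma deg (α : Elem p k A) (i : ℕ) : (α.c i).HasDeg (coeffDeg p k i) := α.2.deg i

lemma re_zero (α : Elem p k A) : (α.c 0).re = 1 := by
  rw [c, pow_zero, α.2.lead]

@[ext]
lemma ext {α β : Elem p k A} (h : ∀ i, (α.c i).re = (β.c i).re)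
    (h' : ∀ i, EpsAllowed p k i → (α.c i).im = (β.c i).im) : α = β := by
  refine Subtype.ext (PowerSeries.ext fun n => ?_)
  by_cases hn : ∃ i, n = p ^ i
  · obtain ⟨i, rfl⟩ := hn
    refine Eps.ext (h i) ?_
    by_cases hi : EpsAllowed p k i
    · exact h' i hi
    · rw [α.2.eps i hi, β.2.eps i hi]
  · have hn' : ∀ i, n ≠ p ^ i := fun i hi => hn ⟨i, hi⟩
    rw [α.2.supp n hn', β.2.supp n hn']

/-- The element with prescribed coefficients. -/
noncomputable def mkSeq (a : ℕ → Eps A) (h : ∀ i, (a i).HasDeg (coeffDeg p k i))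
    (h0 : (a 0).re = 1) (he : ∀ i, ¬ EpsAllowed p k i → (a i).im = 0) : Elem p k A :=
  ⟨ofSeq p a, fun n hn => coeff_ofSeq_ne a n hn, fun i => by rw [coeff_ofSeq]; exact h i,
    by rw [← pow_zero p, coeff_ofSeq, h0], fun i hi => by rw [coeff_ofSeq, he i hi]⟩

@[simp] lemma c_mkSeq (a : ℕ → Eps A) (h : ∀ i, (a i).HasDeg (coeffDeg p k i))
    (h0 : (a 0).re = 1) (he : ∀ i, ¬ EpsAllowed p k i → (a i).im = 0) (i : ℕ) :
    (mkSeq a h h0 he).c i = a i := coeff_ofSeq a i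

lemma re_commute (α : Elem p k A) (i : ℕ) {j : ℤ} {a : A} (ha : a ∈ A.deg j) :
    Commute (α.c i).re a := A.commute_of_dvd (dvd_coeffDeg p k i) (α.deg i).1 ha

lemma coeff_commute (α β : Elem p k A) (m n : ℕ) : Commute (coeff m α.1) (coeff n β.1) := by
  by_cases hm : ∃ i, m = p ^ i
  · by_cases hn : ∃ i, n = p ^ i
    · obtain ⟨i, rfl⟩ := hm
      obtain ⟨j, rfl⟩ := hn
      exact Eps.commute_of_hasDeg (α.deg i) (β.deg j) (dvd_coeffDeg p k i) (dvd_coeffDeg p k j)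
    · rw [β.2.supp n fun i hi => hn ⟨i, hi⟩]
      exact Commute.zero_right _
  · rw [α.2.supp m fun i hi => hm ⟨i, hi⟩]
    exact Commute.zero_left _

lemma coeff_comp' (α β : Elem p k A) (n : ℕ) : coeff (p ^ n) (comp α.1 β.1) =
    ∑ ij ∈ Finset.HasAntidiagonal.antidiagonal n, β.c ij.2 * α.c ij.1 ^ p ^ ij.2 :=
  coeff_comp Eps.natCast_eq_zero (fun _ _ => coeff_commute α α _ _) β.2.supp n

lemma re_comp (α β : Elem p k A) (n : ℕ) : (coeff (p ^ n) (comp α.1 β.1)).re =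
    ∑ ij ∈ Finset.HasAntidiagonal.antidiagonal n, (β.c ij.2).re * (α.c ij.1).re ^ p ^ ij.2 := by
  rw [coeff_comp', ← Eps.reHom_apply, map_sum]
  simp

lemma re_pow_deg (α : Elem p k A) (i m : ℕ) :
    (α.c i).re ^ m ∈ A.deg (m * coeffDeg p k i) := by
  have h := SetLike.pow_mem_graded m (α.deg i).1
  rwa [nsmul_eq_mul] at h

lemma im_comp (α β : Elem p k A) (n : ℕ) : (coeff (p ^ n) (comp α.1 β.1)).im =
    (α.c n).im +
    ∑ ij ∈ Finset.HasAntidiagonal.antidiagonal n, (β.c ij.2).im * (α.c ij.1).re ^ p ^ ij.2 := by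
  rw [coeff_comp', ← Eps.imHom_apply, map_sum]
  have h : ∀ ij ∈ Finset.HasAntidiagonal.antidiagonal n,
      Eps.imHom (β.c ij.2 * α.c ij.1 ^ p ^ ij.2) =
      (if ij = (n, 0) then (α.c n).im else 0) + (β.c ij.2).im * (α.c ij.1).re ^ p ^ ij.2 := by
    rintro ⟨i, j⟩ hij
    rw [Finset.HasAntidiagonal.mem_antidiagonal] at hij
    have hs : A.sgn ((α.c i).re ^ p ^ j) = (α.c i).re ^ p ^ j := by
      rw [map_pow, A.sgn_of_dvd (dvd_coeffDeg p k i) (α.deg i).1]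
    rw [Eps.imHom_apply, Eps.im_mul, Eps.re_pow, hs]
    congr 1
    rcases j with _ | j
    · simp only [add_zero] at hij
      subst hij
      rw [if_pos rfl]
      simp [β.re_zero]
    · rw [Eps.im_pow_p (α.deg i) (dvd_coeffDeg p k i), if_neg (by simp), mul_zero]
  rw [Finset.sum_congr rfl h, Finset.sum_add_distrib, Finset.sum_ite_eq', if_pos (by simp)]

lemma coeffDeg_add (p k i j : ℕ) :
    coeffDeg p k j + (p ^ j : ℕ) * coeffDeg p k i = coeffDeg p k (i + j) := by
  simp only [coeffDeg, pow_add]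
  push_cast
  ring

lemma mul_mem_deg (α : Elem p k A) {n i j : ℕ} (h : i + j = n) {e : ℤ} {b : A}
    (hb : b ∈ A.deg (coeffDeg p k j + e)) :
    b * (α.c i).re ^ p ^ j ∈ A.deg (coeffDeg p k n + e) := by
  have h1 := SetLike.mul_mem_graded hb (α.re_pow_deg i (p ^ j))
  rwa [add_right_comm, coeffDeg_add, h] at h1

lemma comp_isElem_deg (α β : Elem p k A) (n : ℕ) :
    (coeff (p ^ n) (comp α.1 β.1)).HasDeg (coeffDeg p k n) := by
  constructor
  · rw [re_comp]
    refine Submodule.sum_mem _ fun ij hij => ?_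
    have := α.mul_mem_deg (Finset.HasAntidiagonal.mem_antidiagonal.1 hij) (e := 0)
      (b := (β.c ij.2).re) (by simpa using (β.deg ij.2).1)
    simpa using this
  · rw [im_comp]
    refine Submodule.add_mem _ (α.deg n).2 (Submodule.sum_mem _ fun ij hij => ?_)
    exact α.mul_mem_deg (Finset.HasAntidiagonal.mem_antidiagonal.1 hij) (β.deg ij.2).2

lemma prodSeries_supp (α β : Elem p k A) (n : ℕ) (hn : ∀ i, n ≠ p ^ i) :
    coeff n (prodSeries p k α.1 β.1) = 0 := by
  have h := coeff_comp_eq_zero Eps.natCast_eq_zero (fun _ _ => coeff_commute α α _ _)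
    α.2.supp β.2.supp n hn
  rw [prodSeries]
  split_ifs
  · rw [qhat, coeff_mk, h]
    split_ifs <;> rfl
  · exact h

lemma re_prodSeries (α β : Elem p k A) (n : ℕ) : (coeff (p ^ n) (prodSeries p k α.1 β.1)).re =
    ∑ ij ∈ Finset.HasAntidiagonal.antidiagonal n, (β.c ij.2).re * (α.c ij.1).re ^ p ^ ij.2 := by
  rw [← re_comp, prodSeries]
  split_ifs
  · rw [qhat, coeff_mk]
    split_ifs <;> rfl
  · rfl

lemma pow_eq_one_iff' (n : ℕ) : p ^ n = 1 ↔ n = 0 := by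
  rw [Nat.pow_eq_one]
  simp [hp.out.one_lt.ne']

lemma im_prodSeries (α β : Elem p k A) (n : ℕ) (h : EpsAllowed p k n) :
    (coeff (p ^ n) (prodSeries p k α.1 β.1)).im = (α.c n).im +
    ∑ ij ∈ Finset.HasAntidiagonal.antidiagonal n, (β.c ij.2).im * (α.c ij.1).re ^ p ^ ij.2 := by
  rw [← im_comp, prodSeries]
  split_ifs with hk
  · obtain ⟨_, h | ⟨_, rfl⟩⟩ := h
    · omega
    · rw [qhat, coeff_mk, pow_zero, if_pos rfl]
  · rfl

lemma im_prodSeries_of_not (α β : Elem p k A) (n : ℕ) (h : ¬ EpsAllowed p k n) :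
    (coeff (p ^ n) (prodSeries p k α.1 β.1)).im = 0 := by
  rw [prodSeries]
  split_ifs with hk
  · rw [qhat, coeff_mk, if_neg]
    rw [pow_eq_one_iff']
    exact fun h0 => h ⟨hk.1, Or.inr ⟨hk.2, h0⟩⟩
  · have h' : ∀ i, ¬ EpsAllowed p k i := by
      rintro i ⟨h1, h2 | h2⟩
      · exact h ⟨h1, Or.inl h2⟩
      · exact hk ⟨h1, h2.1⟩
    rw [im_comp, show (α.c n).im = 0 from α.2.eps n (h' n), zero_add]
    refine Finset.sum_eq_zero fun ij _ => ?_
    rw [show (β.c ij.2).im = 0 from β.2.eps _ (h' _), zero_mul]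

noncomputable instance : Mul (Elem p k A) := ⟨fun α β => ⟨prodSeries p k α.1 β.1,
  { supp := prodSeries_supp α β
    deg := fun n => by
      refine ⟨?_, ?_⟩
      · rw [re_prodSeries, ← re_comp]
        exact (comp_isElem_deg α β n).1
      · by_cases h : EpsAllowed p k n
        · rw [im_prodSeries _ _ _ h, ← im_comp]
          exact (comp_isElem_deg α β n).2
        · rw [im_prodSeries_of_not _ _ _ h]
          exact Submodule.zero_mem _
    lead := by
      rw [← pow_zero p, re_prodSeries]
      simp [re_zero]
    eps := im_prodSeries_of_not α β }⟩⟩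

lemma coe_mul (α β : Elem p k A) : (α * β).1 = prodSeries p k α.1 β.1 := rfl

lemma re_mul (α β : Elem p k A) (n : ℕ) : ((α * β).c n).re =
    ∑ ij ∈ Finset.HasAntidiagonal.antidiagonal n, (β.c ij.2).re * (α.c ij.1).re ^ p ^ ij.2 :=
  re_prodSeries α β n

lemma im_mul (α β : Elem p k A) (n : ℕ) (h : EpsAllowed p k n) : ((α * β).c n).im = (α.c n).im +
    ∑ ij ∈ Finset.HasAntidiagonal.antidiagonal n, (β.c ij.2).im * (α.c ij.1).re ^ p ^ ij.2 :=
  im_prodSeries α β n h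

lemma X_eq : (X : (Eps A)⟦X⟧) = ofSeq p fun i => if i = 0 then 1 else 0 := by
  ext n : 1
  by_cases hn : ∃ i, n = p ^ i
  · obtain ⟨i, rfl⟩ := hn
    rw [coeff_ofSeq, coeff_X]
    simp only [pow_eq_one_iff']
  · have hn' : ∀ i, n ≠ p ^ i := fun i hi => hn ⟨i, hi⟩
    rw [coeff_ofSeq_ne _ _ hn', coeff_X, if_neg]
    simpa using hn' 0

noncomputable instance : One (Elem p k A) := ⟨⟨X,
  { supp := fun n hn => by rw [coeff_X, if_neg]; simpa using hn 0
    deg := fun i => by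
      rw [X_eq, coeff_ofSeq]
      split_ifs with h
      · subst h
        refine ⟨?_, Submodule.zero_mem _⟩
        simpa [coeffDeg] using SetLike.one_mem_graded A.deg
      · exact ⟨Submodule.zero_mem _, Submodule.zero_mem _⟩
    lead := by simp
    eps := fun i _ => by
      rw [X_eq, coeff_ofSeq]
      split_ifs <;> rfl }⟩⟩

lemma coe_one : (1 : Elem p k A).1 = X := rfl

lemma c_one (i : ℕ) : (1 : Elem p k A).c i = if i = 0 then 1 else 0 := by
  rw [c, coe_one, X_eq, coeff_ofSeq]

lemma mul_one' (α : Elem p k A) : α * 1 = α := by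
  ext n hn
  · rw [re_mul, Finset.sum_eq_single (n, 0)]
    · simp [c_one]
    · rintro ⟨i, j⟩ h h'
      rw [Finset.HasAntidiagonal.mem_antidiagonal] at h
      have hj : j ≠ 0 := by
        rintro rfl
        exact h' (by rw [← h]; rfl)
      simp [c_one, hj]
    · simp
  · rw [im_mul _ _ _ hn, Finset.sum_eq_zero, add_zero]
    rintro ⟨i, j⟩ _
    simp only [c_one]
    split_ifs <;> simp

lemma re_mul_pow (α β : Elem p k A) (m l : ℕ) : ((α * β).c m).re ^ p ^ l =
    ∑ ij ∈ Finset.HasAntidiagonal.antidiagonal m,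
      (β.c ij.2).re ^ p ^ l * (α.c ij.1).re ^ p ^ (ij.2 + l) := by
  rw [re_mul, sum_pow_of_commute A.natCast_eq_zero]
  · refine Finset.sum_congr rfl fun ij _ => ?_
    rw [Commute.mul_pow, ← pow_mul, ← pow_add]
    exact (re_commute β _ (α.deg _).1).pow_right _
  · intro a _ b _
    exact Commute.mul_left
      ((re_commute β _ (β.deg _).1).mul_right ((re_commute β _ (α.deg _).1).pow_right _))
      (((re_commute α _ (β.deg _).1).mul_right
        ((re_commute α _ (α.deg _).1).pow_right _)).pow_left _)

lemma sum_assoc (g : ℕ → A) (α β : Elem p k A) (n : ℕ) :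
    ∑ ml ∈ Finset.HasAntidiagonal.antidiagonal n, g ml.2 * ((α * β).c ml.1).re ^ p ^ ml.2 =
    ∑ il ∈ Finset.HasAntidiagonal.antidiagonal n,
      (∑ jk ∈ Finset.HasAntidiagonal.antidiagonal il.2, g jk.2 * (β.c jk.1).re ^ p ^ jk.2) *
        (α.c il.1).re ^ p ^ il.2 := by
  simp only [re_mul_pow, Finset.mul_sum, Finset.sum_mul]
  rw [sum_antidiagonal_assoc n fun i j l =>
    g l * ((β.c j).re ^ p ^ l * (α.c i).re ^ p ^ (j + l))]
  refine Finset.sum_congr rfl fun il _ => Finset.sum_congr rfl fun jk h => ?_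
  rw [Finset.HasAntidiagonal.mem_antidiagonal] at h
  rw [h, mul_assoc]

lemma EpsAllowed.mono {p k n m : ℕ} (h : EpsAllowed p k n) (hm : m ≤ n) : EpsAllowed p k m :=
  ⟨h.1, h.2.imp_right fun h => ⟨h.1, by omega⟩⟩

lemma mul_assoc' (α β γ : Elem p k A) : α * β * γ = α * (β * γ) := by
  ext n hn
  · rw [re_mul, re_mul, sum_assoc (fun j => (γ.c j).re)]
    simp only [re_mul]
  · rw [im_mul _ _ _ hn, im_mul _ _ _ hn, im_mul _ _ _ hn, sum_assoc (fun j => (γ.c j).im),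
      add_assoc, ← Finset.sum_add_distrib]
    congr 1
    refine Finset.sum_congr rfl fun il h => ?_
    rw [Finset.HasAntidiagonal.mem_antidiagonal] at h
    rw [im_mul _ _ _ (EpsAllowed.mono hn (by omega)), add_mul]

/-- The coefficients of the inverse. -/
noncomputable def invSeq (a b : ℕ → A) (n : ℕ) : A :=
  b n - ∑ j : Fin n, invSeq a b j * a (n - j) ^ p ^ (j : ℕ)
  termination_by n
  decreasing_by exact j.2

lemma invSeq_eq (a b : ℕ → A) (n : ℕ) (h0 : a 0 = 1) :
    ∑ ij ∈ Finset.HasAntidiagonal.antidiagonal n, invSeq a b ij.2 * a ij.1 ^ p ^ ij.2 = b n := by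
  rw [← Finset.Nat.sum_antidiagonal_swap]
  simp only [Prod.fst_swap, Prod.snd_swap]
  rw [Finset.Nat.sum_antidiagonal_eq_sum_range_succ
    (fun j i => invSeq a b j * a i ^ p ^ j), Finset.sum_range_succ, Nat.sub_self, h0, one_pow,
    mul_one, ← Fin.sum_univ_eq_sum_range (fun j => invSeq a b j * a (n - j) ^ p ^ j)]
  conv_lhs => rw [invSeq.eq_1 a b n]
  abel

lemma invSeq_mem (α : Elem p k A) (e : ℤ) (b : ℕ → A)
    (hb : ∀ n, b n ∈ A.deg (coeffDeg p k n + e)) (n : ℕ) :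
    invSeq (fun i => (α.c i).re) b n ∈ A.deg (coeffDeg p k n + e) := by
  induction n using Nat.strong_induction_on with
  | _ n ih =>
    rw [invSeq]
    refine Submodule.sub_mem _ (hb n) (Submodule.sum_mem _ fun j _ => ?_)
    exact α.mul_mem_deg (Nat.sub_add_cancel j.2.le) (ih j j.2)

open Classical in
noncomputable instance : Inv (Elem p k A) := ⟨fun α => mkSeq
  (fun n => ⟨invSeq (fun i => (α.c i).re) (fun i => if i = 0 then 1 else 0) n,
    if EpsAllowed p k n then invSeq (fun i => (α.c i).re) (fun i => -(α.c i).im) n else 0⟩)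
  (fun n => by
    refine ⟨?_, ?_⟩
    · have := invSeq_mem α 0 (fun i => if i = 0 then 1 else 0) (fun n => by
        split_ifs with h
        · subst h
          simpa [coeffDeg] using SetLike.one_mem_graded A.deg
        · exact Submodule.zero_mem _) n
      simpa using this
    · simp only
      split_ifs
      · exact invSeq_mem α 1 _ (fun n => Submodule.neg_mem _ (α.deg n).2) n
      · exact Submodule.zero_mem _)
  (by rw [invSeq]; simp)
  (fun i hi => if_neg hi)⟩

lemma mul_inv' (α : Elem p k A) : α * α⁻¹ = 1 := by
  have hr : ∀ n, (α⁻¹.c n).re =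
      invSeq (fun i => (α.c i).re) (fun i => if i = 0 then 1 else 0) n := fun n => by
    exact congrArg Eps.re (c_mkSeq _ _ _ _ n)
  have hi : ∀ n, EpsAllowed p k n → (α⁻¹.c n).im =
      invSeq (fun i => (α.c i).re) (fun i => -(α.c i).im) n := fun n hn => by
    exact (congrArg Eps.im (c_mkSeq _ _ _ _ n)).trans (if_pos hn)
  ext n hn
  · simp only [re_mul, hr]
    rw [invSeq_eq (fun i => (α.c i).re) _ n α.re_zero, c_one]
    split_ifs <;> rfl
  · rw [im_mul _ _ _ hn]
    have : ∀ ij ∈ Finset.HasAntidiagonal.antidiagonal n,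
        (α⁻¹.c ij.2).im * (α.c ij.1).re ^ p ^ ij.2 =
        invSeq (fun i => (α.c i).re) (fun i => -(α.c i).im) ij.2 *
          (α.c ij.1).re ^ p ^ ij.2 := fun ij h => by
      rw [Finset.HasAntidiagonal.mem_antidiagonal] at h
      rw [hi _ (EpsAllowed.mono hn (by omega))]
    rw [Finset.sum_congr rfl this, invSeq_eq (fun i => (α.c i).re) _ n α.re_zero, c_one,
      add_neg_cancel]
    split_ifs <;> rfl

noncomputable instance : Group (Elem p k A) :=
  Group.ofRightAxioms mul_assoc' mul_one' mul_inv'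

/-- The map `G_p^⟨k⟩(A) → G_p^⟨k⟩(B)` induced by `A → B`. -/
noncomputable def mapFun (f : A ⟶ B) (α : Elem p k A) : Elem p k B :=
  ⟨PowerSeries.map (Eps.map f) α.1,
    { supp := fun n hn => by rw [coeff_map, α.2.supp n hn, map_zero]
      deg := fun i => by
        rw [coeff_map]
        exact ⟨f.map_deg (α.deg i).1, f.map_deg (α.deg i).2⟩
      lead := by simp [α.2.lead]
      eps := fun i hi => by rw [coeff_map, Eps.im_map, α.2.eps i hi, map_zero] }⟩

lemma c_mapFun (f : A ⟶ B) (α : Elem p k A) (i : ℕ) :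
    (mapFun f α).c i = Eps.map f (α.c i) := by
  simp [mapFun, c]

/-- The homomorphism `G_p^⟨k⟩(A) → G_p^⟨k⟩(B)` induced by `A → B`. -/
noncomputable def map (f : A ⟶ B) : Elem p k A →* Elem p k B :=
  MonoidHom.mk' (mapFun f) (by
    intro α β
    ext n hn
    · simp [re_mul, c_mapFun, map_sum]
    · simp [im_mul _ _ _ hn, c_mapFun, map_sum])

@[simp] lemma c_map (f : A ⟶ B) (α : Elem p k A) (i : ℕ) :
    (map f α).c i = Eps.map f (α.c i) := c_mapFun f α i

/-- The homomorphism `ρ_k : G_p^⟨k⟩(A) → G_p^⟨k+1⟩(A)`: it sends `∑ αᵢ X^(p^i)` to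
`α₀ X + ∑_{i ≥ 1} αᵢ^p X^(p^i)` if `k = 0` and to `X + ∑_{i ≥ 1} αᵢ^p X^(p^i)` if `k ≥ 1`. -/
noncomputable def rho (k : ℕ) (A : GrAlg.{u} p) : Elem p k A →* Elem p (k + 1) A :=
  MonoidHom.mk' (fun α => mkSeq
    (fun i => if i = 0 then (if k = 0 then α.c 0 else 1) else α.c i ^ p)
    (fun i => by
      split_ifs with h h'
      · subst h h'
        simpa [coeffDeg] using α.deg 0
      · subst h
        refine ⟨?_, Submodule.zero_mem _⟩
        simpa [coeffDeg] using SetLike.one_mem_graded A.deg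
      · have h1 := Eps.im_pow_p (α.deg i) (dvd_coeffDeg p k i) 0
        rw [zero_add, pow_one] at h1
        refine ⟨?_, by rw [h1]; exact Submodule.zero_mem _⟩
        rw [Eps.re_pow]
        have h2 := α.re_pow_deg i p
        rwa [show (p : ℤ) * coeffDeg p k i = coeffDeg p (k + 1) i by
          simp only [coeffDeg]; ring] at h2)
    (by
      simp only [if_true]
      split_ifs
      · exact α.re_zero
      · rfl)
    (fun i hi => by
      split_ifs with h h'
      · subst h h'
        refine α.2.eps 0 fun h => hi ⟨h.1, by simp⟩
      · rfl
      · have h1 := Eps.im_pow_p (α.deg i) (dvd_coeffDeg p k i) 0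
        rwa [zero_add, pow_one] at h1)) (by
    intro α β
    have hre : ∀ (γ : Elem p k A) (i : ℕ),
        Eps.re (if i = 0 then (if k = 0 then γ.c 0 else 1) else γ.c i ^ p) = (γ.c i).re ^ p := by
      intro γ i
      split_ifs with h
      · rw [h, γ.re_zero, one_pow]
      · rw [h, γ.re_zero, one_pow]; rfl
      · rw [Eps.re_pow]
    ext n hn
    · simp only [re_mul (k := k + 1), c_mkSeq, hre]
      have := re_mul_pow α β n 1
      rw [pow_one] at this
      rw [this]
      refine Finset.sum_congr rfl fun ij _ => ?_
      rw [pow_succ', pow_mul]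
    · obtain ⟨h1, h2⟩ := hn
      have hk : k = 0 := by omega
      have hn : n = 0 := by omega
      subst hk hn
      rw [im_mul _ _ _ ⟨h1, h2⟩]
      simp [im_mul _ _ _ (show EpsAllowed p 0 0 from ⟨h1, Or.inl rfl⟩)])

lemma c_rho (α : Elem p k A) (i : ℕ) : (rho k A α).c i =
    if i = 0 then (if k = 0 then α.c 0 else 1) else α.c i ^ p := by
  simp [rho]

end Elem

/-- The group functor `G_p^⟨k⟩`, with `G_p^⟨0⟩ = G_p`. -/
noncomputable def G (p : ℕ) [Fact p.Prime] (k : ℕ) : GrAlg.{u} p ⥤ GrpCat.{u} where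
  obj A := GrpCat.of (Elem p k A)
  map f := GrpCat.ofHom (Elem.map f)
  map_id A := by
    have h : Elem.map (k := k) (𝟙 A) = MonoidHom.id _ :=
      MonoidHom.ext fun α => Elem.ext
        (fun i => congrArg Eps.re (Elem.c_map (𝟙 A) α i))
        (fun i _ => congrArg Eps.im (Elem.c_map (𝟙 A) α i))
    rw [h]
    rfl
  map_comp f g := by
    have h : Elem.map (k := k) (f ≫ g) = (Elem.map g).comp (Elem.map f) :=
      MonoidHom.ext fun α => Elem.ext (fun i => by simp) (fun i _ => by simp)
    rw [h]
    rfl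

/-- The homomorphism `ρ_k : G_p^⟨k⟩ → G_p^⟨k+1⟩`. -/
noncomputable def rho (p : ℕ) [Fact p.Prime] (k : ℕ) : G.{u} p k ⟶ G.{u} p (k + 1) where
  app A := GrpCat.ofHom (Elem.rho k A)
  naturality A B f := by
    refine GrpCat.hom_ext (MonoidHom.ext fun α => ?_)
    have h : ∀ α, Elem.rho k B (Elem.map f α) = Elem.map f (Elem.rho k A α) := by
      intro α
      have hc : ∀ i, (Elem.rho k B (Elem.map f α)).c i = (Elem.map f (Elem.rho k A α)).c i := by
        intro i
        simp only [Elem.c_rho, Elem.c_map]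
        split_ifs <;> simp
      exact Elem.ext (fun i => by rw [hc]) (fun i _ => by rw [hc])
    exact h α

/-- A subgroup functor of a group functor. -/
@[ext]
structure SubgroupFunctor {p : ℕ} (F : GrAlg.{u} p ⥤ GrpCat.{u}) where
  obj : ∀ A, Subgroup (F.obj A)
  map_mem : ∀ {A B : GrAlg.{u} p} (f : A ⟶ B) {g : F.obj A}, g ∈ obj A → F.map f g ∈ obj B

namespace SubgroupFunctor

variable {p : ℕ} {F F' : GrAlg.{u} p ⥤ GrpCat.{u}}

instance : LE (SubgroupFunctor F) := ⟨fun S T => ∀ A, S.obj A ≤ T.obj A⟩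

/-- A subgroup functor regarded as a group functor. -/
def toFunctor (S : SubgroupFunctor F) : GrAlg.{u} p ⥤ GrpCat.{u} where
  obj A := GrpCat.of (S.obj A)
  map {A B} f := GrpCat.ofHom
    (((F.map f).hom.comp (S.obj A).subtype).codRestrict (S.obj B) fun g => S.map_mem f g.2)
  map_id A := by
    refine GrpCat.hom_ext (MonoidHom.ext fun g => ?_)
    exact Subtype.ext (congrArg (fun φ => φ.hom g.1) (F.map_id A))
  map_comp f g := by
    refine GrpCat.hom_ext (MonoidHom.ext fun x => ?_)
    exact Subtype.ext (congrArg (fun φ => φ.hom x.1) (F.map_comp f g))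

/-- The kernel of a homomorphism of group functors. -/
def ker (φ : F ⟶ F') : SubgroupFunctor F where
  obj A := (φ.app A).hom.ker
  map_mem {A B} f g hg := by
    rw [MonoidHom.mem_ker] at hg ⊢
    have h : φ.app B (F.map f g) = F'.map f (φ.app A g) := NatTrans.naturality_apply φ f g
    exact h.trans ((congrArg _ hg).trans (map_one _))

/-- A subgroup functor is normal if all its values are normal subgroups. -/
def IsNormal (S : SubgroupFunctor F) : Prop := ∀ A, (S.obj A).Normal

end SubgroupFunctor

/-- A homomorphism `f : A → B` of graded commutative algebras is faithfully flat. Flatness of the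
`A`-module `B` is expressed by the equational criterion (every linear relation in `B` with coefficients in
`A` is a consequence of linear relations in `A`); faithfulness says that `I B ≠ B` for
every proper right ideal `I` of `A`. -/
structure FaithfullyFlat {p : ℕ} {A B : GrAlg.{u} p} (f : A ⟶ B) : Prop where
  flat : ∀ (n : ℕ) (a : Fin n → A) (b : Fin n → B), ∑ i, f.toAlgHom (a i) * b i = 0 →
    ∃ (m : ℕ) (c : Fin n → Fin m → A) (y : Fin m → B),
      (∀ i, b i = ∑ j, f.toAlgHom (c i j) * y j) ∧ ∀ j, ∑ i, a i * c i j = 0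
  faithful : ∀ (n : ℕ) (a : Fin n → A) (b : Fin n → B), ∑ i, f.toAlgHom (a i) * b i = 1 →
    ∃ c : Fin n → A, ∑ i, a i * c i = 1

/-- For subgroup functors `N`, `H` of `F`, the homomorphism `π : H → Q` exhibits the affine group scheme `Q`
as the quotient `H/N`, i.e. as the sheaf associated with `A ↦ H(A)/N(A)` for the faithfully flat topology:
`N` is contained in `H`, the kernel of `π` is `N`, and every
element of `Q(A)` lifts to `H(B)` for some faithfully flat `A → B`. -/
structure IsQuotientMap {p : ℕ} {F : GrAlg.{u} p ⥤ GrpCat.{u}} (H N : SubgroupFunctor F)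
    {Q : GrAlg.{u} p ⥤ GrpCat.{u}} (π : H.toFunctor ⟶ Q) : Prop where
  affine : (Q ⋙ forget GrpCat.{u}).IsCorepresentable
  le : N ≤ H
  ker : ∀ (A : GrAlg.{u} p) (h : H.obj A), π.app A h = 1 ↔ (h : F.obj A) ∈ N.obj A
  surj : ∀ (A : GrAlg.{u} p) (q : Q.obj A), ∃ (B : GrAlg.{u} p) (f : A ⟶ B),
    FaithfullyFlat f ∧ ∃ h : H.obj B, π.app B h = Q.map f q

/-- Generators of the dual Steenrod algebra: `xi n` stands for `ξ_{n+1}` (`ζ_{n+1}` if `p = 2`), and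
`tau _ n` for `τ_n` (only for `p ≠ 2`). -/
inductive Gen (p : ℕ) : Type u
  | xi (n : ℕ) : Gen p
  | tau (h : p ≠ 2) (n : ℕ) : Gen p

/-- `|ξ_n| = 2 (p^n - 1)` (`|ζ_n| = 2^n - 1` if `p = 2`) and `|τ_n| = 2 p^n - 1`. -/
def Gen.deg {p : ℕ} : Gen.{u} p → ℤ
  | xi n => GrAlg.unitDeg p * ((p : ℤ) ^ (n + 1) - 1)
  | tau _ n => 2 * (p : ℤ) ^ n - 1

/-- The relations defining `𝔽_p[ξ₁, ξ₂, …] ⊗ E(τ₀, τ₁, …)` as a quotient of the free algebra. -/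
inductive DualRel (p : ℕ) : FreeAlgebra (ZMod p) (Gen.{u} p) → FreeAlgebra (ZMod p) (Gen.{u} p) → Prop
  | xi_comm (n : ℕ) (g : Gen.{u} p) : DualRel p
      (FreeAlgebra.ι (ZMod p) (Gen.xi n) * FreeAlgebra.ι (ZMod p) g)
      (FreeAlgebra.ι (ZMod p) g * FreeAlgebra.ι (ZMod p) (Gen.xi n))
  | tau_anti (h : p ≠ 2) (m n : ℕ) : DualRel p
      (FreeAlgebra.ι (ZMod p) (Gen.tau h m) * FreeAlgebra.ι (ZMod p) (Gen.tau h n))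
      (-(FreeAlgebra.ι (ZMod p) (Gen.tau h n) * FreeAlgebra.ι (ZMod p) (Gen.tau h m)))
  | tau_sq (h : p ≠ 2) (n : ℕ) : DualRel p
      (FreeAlgebra.ι (ZMod p) (Gen.tau h n) * FreeAlgebra.ι (ZMod p) (Gen.tau h n)) 0

/-- The algebra underlying the dual Steenrod algebra: `𝔽₂[ζ₁, ζ₂, …]` for `p = 2`, and
`E(τ₀, τ₁, …) ⊗ 𝔽_p[ξ₁, ξ₂, …]` for odd `p`. -/
def DualAlg (p : ℕ) : Type u := RingQuot (DualRel.{u} p)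

namespace DualAlg

variable {p : ℕ}

instance : Ring (DualAlg.{u} p) := inferInstanceAs (Ring (RingQuot (DualRel.{u} p)))

instance : Algebra (ZMod p) (DualAlg.{u} p) :=
  inferInstanceAs (Algebra (ZMod p) (RingQuot (DualRel.{u} p)))

/-- The quotient map from the free algebra. -/
noncomputable def mk (p : ℕ) : FreeAlgebra (ZMod p) (Gen.{u} p) →ₐ[ZMod p] DualAlg.{u} p :=
  RingQuot.mkAlgHom (ZMod p) (DualRel.{u} p)

/-- The class of a generator. -/
noncomputable def gen (g : Gen.{u} p) : DualAlg.{u} p :=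
  mk p (FreeAlgebra.ι (ZMod p) g)

/-- Algebra homomorphisms from the dual Steenrod algebra defined on generators. -/
noncomputable def lift {C : Type v} [Ring C] [Algebra (ZMod p) C] (f : Gen.{u} p → C)
    (h1 : ∀ n g, f (.xi n) * f g = f g * f (.xi n))
    (h2 : ∀ h m n, f (.tau h m) * f (.tau h n) = -(f (.tau h n) * f (.tau h m)))
    (h3 : ∀ h n, f (.tau h n) * f (.tau h n) = 0) : DualAlg.{u} p →ₐ[ZMod p] C :=
  RingQuot.liftAlgHom (ZMod p) ⟨FreeAlgebra.lift (ZMod p) f, by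
    intro x y h
    induction h with
    | xi_comm n g => simpa using h1 n g
    | tau_anti h m n => simpa using h2 h m n
    | tau_sq h n => simpa using h3 h n⟩

@[simp] lemma lift_gen {C : Type v} [Ring C] [Algebra (ZMod p) C] (f : Gen.{u} p → C)
    (h1 : ∀ n g, f (.xi n) * f g = f g * f (.xi n))
    (h2 : ∀ h m n, f (.tau h m) * f (.tau h n) = -(f (.tau h n) * f (.tau h m)))
    (h3 : ∀ h n, f (.tau h n) * f (.tau h n) = 0) (g : Gen.{u} p) :
    lift f h1 h2 h3 (gen g) = f g := by
  exact (RingQuot.liftAlgHom_mkAlgHom_apply _ _ _ _).trans (FreeAlgebra.lift_ι_apply _ _)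

lemma algHom_ext {C : Type v} [Ring C] [Algebra (ZMod p) C] {f f' : DualAlg.{u} p →ₐ[ZMod p] C}
    (h : ∀ g, f (gen g) = f' (gen g)) : f = f' := by
  apply RingQuot.ringQuot_ext'
  apply FreeAlgebra.hom_ext
  funext g
  exact h g

lemma xi_comm (n : ℕ) (g : Gen.{u} p) : gen (.xi n) * gen g = gen g * gen (.xi n) := by
  rw [gen, gen, ← map_mul, ← map_mul]
  exact RingQuot.mkAlgHom_rel _ (.xi_comm n g)

lemma tau_anti (h : p ≠ 2) (m n : ℕ) :
    gen.{u} (.tau h m) * gen (.tau h n) = -(gen (.tau h n) * gen (.tau h m)) := by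
  rw [gen, gen, ← map_mul, ← map_mul, ← map_neg]
  exact RingQuot.mkAlgHom_rel _ (.tau_anti h m n)

lemma tau_sq (h : p ≠ 2) (n : ℕ) : gen.{u} (.tau h n) * gen (.tau h n) = 0 := by
  rw [gen, ← map_mul, ← map_zero (mk p)]
  exact RingQuot.mkAlgHom_rel _ (.tau_sq h n)

/-- The monomial with the given list of factors. -/
noncomputable def mon (l : List (Gen.{u} p)) : DualAlg.{u} p := (l.map gen).prod

/-- The degree of a monomial. -/
def monDeg (l : List (Gen.{u} p)) : ℤ := (l.map Gen.deg).sum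

/-- The homogeneous elements of degree `n`: the span of the monomials of degree `n`. -/
noncomputable def deg (p : ℕ) (n : ℤ) : Submodule (ZMod p) (DualAlg.{u} p) :=
  Submodule.span (ZMod p) {x | ∃ l, monDeg l = n ∧ mon l = x}

lemma mon_mem (l : List (Gen.{u} p)) : mon l ∈ deg p (monDeg l) :=
  Submodule.subset_span ⟨l, rfl, rfl⟩

lemma gen_mem (g : Gen.{u} p) : gen g ∈ deg p g.deg := by
  simpa [mon, monDeg] using mon_mem [g]

instance : SetLike.GradedMonoid (deg.{u} p) where
  one_mem := mon_mem []
  mul_mem := by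
    intro i j a b ha hb
    induction ha using Submodule.span_induction with
    | mem x hx =>
      obtain ⟨l, rfl, rfl⟩ := hx
      induction hb using Submodule.span_induction with
      | mem y hy =>
        obtain ⟨m, rfl, rfl⟩ := hy
        have := mon_mem (l ++ m)
        simpa [mon, monDeg] using this
      | zero => simp
      | add y z _ _ h1 h2 => rw [mul_add]; exact Submodule.add_mem _ h1 h2
      | smul r y _ h => rw [mul_smul_comm]; exact Submodule.smul_mem _ _ h
    | zero => simp
    | add y z _ _ h1 h2 => rw [add_mul]; exact Submodule.add_mem _ h1 h2
    | smul r y _ h => rw [smul_mul_assoc]; exact Submodule.smul_mem _ _ h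

/-- The homogeneous components of a generator. -/
noncomputable def decGen (g : Gen.{u} p) : ⨁ i, deg.{u} p i :=
  DirectSum.of (fun i => deg.{u} p i) g.deg ⟨gen g, gen_mem g⟩

lemma of_congr {i j : ℤ} {x : deg.{u} p i} {y : deg.{u} p j} (h : i = j)
    (h' : (x : DualAlg.{u} p) = y) :
    DirectSum.of (fun i => deg.{u} p i) i x = DirectSum.of (fun i => deg.{u} p i) j y := by
  subst h
  rw [Subtype.ext h']

/-- The decomposition into homogeneous components. -/
noncomputable def dec (p : ℕ) : DualAlg.{u} p →ₐ[ZMod p] ⨁ i, deg.{u} p i :=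
  lift (decGen (p := p))
    (fun n g => by
      rw [decGen, decGen, DirectSum.of_mul_of, DirectSum.of_mul_of]
      exact of_congr (add_comm _ _) (xi_comm n g))
    (fun h m n => by
      rw [decGen, decGen, DirectSum.of_mul_of, DirectSum.of_mul_of, ← map_neg]
      exact of_congr (add_comm _ _) (tau_anti h m n))
    (fun h n => by
      rw [decGen, DirectSum.of_mul_of, ← map_zero (DirectSum.of (fun i => deg.{u} p i)
        ((Gen.tau h n).deg + (Gen.tau h n).deg))]
      exact of_congr rfl (tau_sq h n))

lemma dec_mon (l : List (Gen.{u} p)) : dec p (mon l) =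
    DirectSum.of (fun i => deg.{u} p i) (monDeg l) ⟨mon l, mon_mem l⟩ := by
  induction l with
  | nil => exact (map_one _).trans (of_congr rfl rfl)
  | cons g l ih =>
    have h : mon (g :: l) = gen g * mon l := by simp [mon]
    refine (congrArg _ h).trans ?_
    rw [map_mul, ih, dec, lift_gen, decGen, DirectSum.of_mul_of]
    exact of_congr (by simp [monDeg]) h.symm

noncomputable instance : GradedAlgebra (deg.{u} p) :=
  GradedAlgebra.ofAlgHom _ (dec p)
    (algHom_ext fun g => by simp [dec, decGen])
    (fun i x => by
      obtain ⟨x, hx⟩ := x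
      induction hx using Submodule.span_induction with
      | mem x hx =>
        obtain ⟨l, rfl, rfl⟩ := hx
        exact dec_mon l
      | zero => exact (map_zero _).trans (map_zero _).symm
      | add x y hx hy h1 h2 =>
        simp only at h1 h2
        rw [map_add, h1, h2, ← map_add]
        rfl
      | smul r x hx h =>
        simp only at h
        rw [map_smul, h, ← DirectSum.lof_eq_of (ZMod p), ← map_smul]
        rfl)

end DualAlg

namespace DualAlg

variable {p : ℕ}

lemma smul_swap {M : Type*} [AddCommGroup M] (s : ℤˣ) {x y : M} (h : x = s • y) : y = s • x := by
  rw [h, smul_smul, Int.units_mul_self, one_smul]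

lemma negOnePow_xi {M : Type*} [AddCommGroup M] [Module (ZMod p) M] (n : ℕ) (g : Gen.{u} p)
    (x : M) : ((Gen.xi n : Gen.{u} p).deg * g.deg).negOnePow • x = x :=
  GrAlg.negOnePow_smul ((dvd_mul_right _ _).mul_right _) x

lemma gen_comm (g g' : Gen.{u} p) :
    gen g * gen g' = (g.deg * g'.deg).negOnePow • (gen g' * gen g) := by
  rcases g with n | ⟨h, n⟩
  · rw [negOnePow_xi, xi_comm]
  · rcases g' with m | ⟨h', m⟩
    · rw [mul_comm (Gen.deg _), negOnePow_xi, xi_comm]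
    · rw [tau_anti, Int.negOnePow_odd, Units.neg_smul, one_smul]
      exact Odd.mul ⟨(p : ℤ) ^ n - 1, by simp only [Gen.deg]; ring⟩
        ⟨(p : ℤ) ^ m - 1, by simp only [Gen.deg]; ring⟩

lemma comm_mon (x : DualAlg.{u} p) (i : ℤ)
    (hx : ∀ g, x * gen g = (i * g.deg).negOnePow • (gen g * x)) (l : List (Gen.{u} p)) :
    x * mon l = (i * monDeg l).negOnePow • (mon l * x) := by
  induction l with
  | nil => simp [mon, monDeg]
  | cons g l ih =>
    have h : mon (g :: l) = gen g * mon l := by simp [mon]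
    have h' : monDeg (g :: l) = g.deg + monDeg l := by simp [monDeg]
    rw [h, h', mul_add, Int.negOnePow_add, ← mul_assoc, hx, smul_mul_assoc, mul_assoc, ih,
      mul_smul_comm, smul_smul, mul_assoc]

lemma graded_comm {i j : ℤ} {a b : DualAlg.{u} p} (ha : a ∈ deg p i) (hb : b ∈ deg p j) :
    a * b = (i * j).negOnePow • (b * a) := by
  induction ha using Submodule.span_induction with
  | mem x hx =>
    obtain ⟨l, rfl, rfl⟩ := hx
    induction hb using Submodule.span_induction with
    | mem y hy =>
      obtain ⟨m, rfl, rfl⟩ := hy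
      refine comm_mon _ _ (fun g => ?_) m
      refine smul_swap _ ?_
      rw [mul_comm]
      exact comm_mon _ _ (gen_comm g) l
    | zero => simp
    | add y z _ _ h1 h2 => rw [mul_add, h1, h2, add_mul, smul_add]
    | smul r y _ h => rw [mul_smul_comm, h, smul_mul_assoc, smul_comm]
  | zero => simp
  | add y z _ _ h1 h2 => rw [add_mul, h1, h2, mul_add, smul_add]
  | smul r y _ h => rw [smul_mul_assoc, h, mul_smul_comm, smul_comm]

/-- Algebra homomorphisms defined on generators, for targets in which the images of the generators
commute in the graded sense. -/
noncomputable def liftComm [Fact p.Prime] {C : Type v} [Ring C] [Algebra (ZMod p) C]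
    (D : ℤ → Set C)
    (hD : ∀ {i j : ℤ} {a b : C}, a ∈ D i → b ∈ D j → a * b = (i * j).negOnePow • (b * a))
    (f : Gen.{u} p → C) (hf : ∀ g, f g ∈ D g.deg) : DualAlg.{u} p →ₐ[ZMod p] C :=
  have h2 : ∀ h m n, f (.tau h m) * f (.tau h n) = -(f (.tau h n) * f (.tau h m)) :=
    fun h m n => by
      rw [hD (hf _) (hf _), Int.negOnePow_odd, Units.neg_smul, one_smul]
      exact Odd.mul ⟨(p : ℤ) ^ m - 1, by simp only [Gen.deg]; ring⟩
        ⟨(p : ℤ) ^ n - 1, by simp only [Gen.deg]; ring⟩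
  lift f
    (fun n g => by
      rw [hD (hf _) (hf _), negOnePow_xi])
    h2
    (fun h n => by
      have h3 : (2 : ZMod p) • (f (.tau h n) * f (.tau h n)) = 0 := by
        rw [two_smul]
        nth_rewrite 1 [h2 h n n]
        exact neg_add_cancel _
      have h4 : (2 : ZMod p) ≠ 0 := by
        intro h4
        have h5 : ((2 : ℕ) : ZMod p) = 0 := by exact_mod_cast h4
        rw [ZMod.natCast_eq_zero_iff] at h5
        exact h ((Nat.prime_dvd_prime_iff_eq Fact.out Nat.prime_two).1 h5)
      exact (smul_eq_zero_iff_right h4).1 h3)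

@[simp] lemma liftComm_gen [Fact p.Prime] {C : Type v} [Ring C] [Algebra (ZMod p) C]
    (D : ℤ → Set C)
    (hD : ∀ {i j : ℤ} {a b : C}, a ∈ D i → b ∈ D j → a * b = (i * j).negOnePow • (b * a))
    (f : Gen.{u} p → C) (hf : ∀ g, f g ∈ D g.deg) (g : Gen.{u} p) :
    liftComm D hD f hf (gen g) = f g := by
  rw [liftComm, lift_gen]

end DualAlg

/-- The dual Steenrod algebra `𝒜_{p*}` as a graded commutative algebra. -/
noncomputable def dual (p : ℕ) : GrAlg.{u} p where
  carrier := DualAlg.{u} p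
  deg := DualAlg.deg p
  comm := DualAlg.graded_comm

/-- The element `ξ_n` (`ζ_n` if `p = 2`), with `ξ_0 = 1`. -/
noncomputable def xi (p : ℕ) : ℕ → dual.{u} p
  | 0 => (1 : DualAlg.{u} p)
  | n + 1 => DualAlg.gen (.xi n)

/-- The element `τ_n`; by convention it is `0` if `p = 2`. -/
noncomputable def tau (p n : ℕ) : dual.{u} p :=
  (if h : p = 2 then 0 else DualAlg.gen (.tau h n) : DualAlg.{u} p)

section Tensor

variable {p : ℕ}

/-- The graded tensor product `A ⊗ A`, with `(a ⊗ b) (c ⊗ d) = (-1)^{|b| |c|} a c ⊗ b d`. -/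
abbrev Tens (A : GrAlg.{u} p) : Type u := GradedTensorProduct (ZMod p) A.deg A.deg

/-- The tensor `a ⊗ b`. -/
noncomputable abbrev tens {A : GrAlg.{u} p} (a b : A) : Tens A :=
  GradedTensorProduct.tmul (ZMod p) a b

/-- The elements of degree `n` in `A ⊗ A`. -/
noncomputable def tensDeg (A : GrAlg.{u} p) (n : ℤ) : AddSubmonoid (Tens A) :=
  AddSubmonoid.closure
    {x | ∃ (i j : ℤ) (a b : A), a ∈ A.deg i ∧ b ∈ A.deg j ∧ i + j = n ∧ tens a b = x}

lemma tens_mem {A : GrAlg.{u} p} {i j n : ℤ} {a b : A} (ha : a ∈ A.deg i) (hb : b ∈ A.deg j)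
    (h : i + j = n) : tens a b ∈ tensDeg A n :=
  AddSubmonoid.subset_closure ⟨i, j, a, b, ha, hb, h, rfl⟩

lemma tens_mul {A : GrAlg.{u} p} {j k : ℤ} (a : A) {b c : A} (d : A) (hb : b ∈ A.deg j)
    (hc : c ∈ A.deg k) : tens a b * tens c d = (j * k).negOnePow • tens (a * c) (b * d) :=
  GradedTensorProduct.tmul_coe_mul_coe_tmul (R := ZMod p) A.deg A.deg a ⟨b, hb⟩ ⟨c, hc⟩ d

lemma tens_smul {A : GrAlg.{u} p} (s : ℤˣ) (a b : A) : tens (s • a) b = s • tens a b := by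
  rcases Int.units_eq_one_or s with rfl | rfl <;> simp [tens, GradedTensorProduct.tmul,
    TensorProduct.neg_tmul]

lemma tens_smul' {A : GrAlg.{u} p} (s : ℤˣ) (a b : A) : tens a (s • b) = s • tens a b := by
  rcases Int.units_eq_one_or s with rfl | rfl <;> simp [tens, GradedTensorProduct.tmul,
    TensorProduct.tmul_neg]

lemma tensDeg_comm (A : GrAlg.{u} p) {m n : ℤ} {x y : Tens A} (hx : x ∈ tensDeg A m)
    (hy : y ∈ tensDeg A n) : x * y = (m * n).negOnePow • (y * x) := by
  induction hx using AddSubmonoid.closure_induction with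
  | mem x hx =>
    obtain ⟨i, j, a, b, ha, hb, rfl, rfl⟩ := hx
    induction hy using AddSubmonoid.closure_induction with
    | mem y hy =>
      obtain ⟨k, l, c, d, hc, hd, rfl, rfl⟩ := hy
      rw [tens_mul a d hb hc, tens_mul c b hd ha, A.comm ha hc, A.comm hb hd, tens_smul,
        tens_smul', smul_smul, smul_smul, smul_smul]
      congr 1
      rw [← Int.negOnePow_add, ← Int.negOnePow_add, ← Int.negOnePow_add, Int.negOnePow_eq_iff]
      exact ⟨-(i * l), by ring⟩
    | zero => rw [mul_zero, zero_mul, smul_zero]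
    | add y z _ _ h1 h2 => rw [mul_add, h1, h2, add_mul y z, smul_add]
  | zero => rw [mul_zero, zero_mul, smul_zero]
  | add y z _ _ h1 h2 => rw [add_mul, h1, h2, mul_add, smul_add]

end Tensor

section Hopf

variable (p : ℕ)

lemma xi_mem (n : ℕ) : xi.{u} p n ∈ (dual.{u} p).deg (coeffDeg p 0 n) := by
  cases n with
  | zero =>
    have h : coeffDeg p 0 0 = 0 := by simp [coeffDeg]
    rw [h]
    exact SetLike.one_mem_graded (DualAlg.deg.{u} p)
  | succ n =>
    have h : coeffDeg p 0 (n + 1) = (Gen.xi n : Gen.{u} p).deg := by simp [coeffDeg, Gen.deg]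
    rw [h]
    exact DualAlg.gen_mem (.xi n : Gen.{u} p)

lemma tau_mem (n : ℕ) : tau.{u} p n ∈ (dual.{u} p).deg (2 * (p : ℤ) ^ n - 1) := by
  by_cases h : p = 2
  · have e : tau.{u} p n = (0 : DualAlg.{u} p) := dif_pos h
    rw [e]
    exact Submodule.zero_mem (DualAlg.deg.{u} p _)
  · have e : tau.{u} p n = DualAlg.gen (.tau h n) := dif_neg h
    rw [e]
    exact DualAlg.gen_mem (.tau h n)

lemma xi_pow_mem (i j : ℕ) :
    xi.{u} p i ^ p ^ j ∈ (dual.{u} p).deg ((p ^ j : ℕ) * coeffDeg p 0 i) := by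
  have h := SetLike.pow_mem_graded (p ^ j) (xi_mem.{u} p i)
  rwa [nsmul_eq_mul] at h

lemma tau_deg_eq (h : p ≠ 2) (i j : ℕ) :
    (p ^ j : ℕ) * coeffDeg p 0 i + (2 * (p : ℤ) ^ j - 1) = 2 * (p : ℤ) ^ (i + j) - 1 := by
  simp only [coeffDeg, GrAlg.unitDeg, if_neg h, pow_add]
  push_cast
  ring

variable [Fact p.Prime]

/-- The coproduct `μ` on generators: `μ(ξ_n) = ∑_{i+j=n} ξ_i^{p^j} ⊗ ξ_j` and
`μ(τ_n) = ∑_{i+j=n} ξ_i^{p^j} ⊗ τ_j + τ_n ⊗ 1`. -/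
noncomputable def comulGen : Gen.{u} p → Tens (dual.{u} p)
  | .xi n => ∑ ij ∈ Finset.HasAntidiagonal.antidiagonal (n + 1),
      tens (xi p ij.1 ^ p ^ ij.2) (xi p ij.2)
  | .tau _ n => ∑ ij ∈ Finset.HasAntidiagonal.antidiagonal n,
      tens (xi p ij.1 ^ p ^ ij.2) (tau p ij.2) + tens (tau p n) 1

lemma comulGen_mem (g : Gen.{u} p) : comulGen p g ∈ tensDeg (dual.{u} p) g.deg := by
  rcases g with n | ⟨h, n⟩
  · refine AddSubmonoid.sum_mem _ fun ij hij => ?_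
    rw [Finset.HasAntidiagonal.mem_antidiagonal] at hij
    refine tens_mem (xi_pow_mem p _ _) (xi_mem p _) ?_
    rw [add_comm, Elem.coeffDeg_add, hij]
    simp [coeffDeg, Gen.deg]
  · refine AddSubmonoid.add_mem _ (AddSubmonoid.sum_mem _ fun ij hij => ?_)
      (tens_mem (tau_mem p n) (SetLike.one_mem_graded (dual.{u} p).deg) (add_zero _))
    rw [Finset.HasAntidiagonal.mem_antidiagonal] at hij
    refine tens_mem (xi_pow_mem p _ _) (tau_mem p _) ?_
    rw [tau_deg_eq p h, hij]
    rfl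

/-- The coproduct `μ : 𝒜_{p*} → 𝒜_{p*} ⊗ 𝒜_{p*}`. -/
noncomputable def comul : dual.{u} p →ₐ[ZMod p] Tens (dual.{u} p) :=
  DualAlg.liftComm (fun n => tensDeg (dual.{u} p) n) (tensDeg_comm _) (comulGen p) (comulGen_mem p)

/-- The counit `𝒜_{p*} → 𝔽_p`, which vanishes on all generators. -/
noncomputable def counit : dual.{u} p →ₐ[ZMod p] ZMod p :=
  DualAlg.lift (fun _ => 0) (by simp) (by simp) (by simp)

/-- The elements `ι(ξ_n)`, determined by `ι(ξ_0) = 1` and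
`∑_{k ≤ n} ξ_{n-k}^{p^k} ι(ξ_k) = 0` for `n ≥ 1`. -/
noncomputable def conjXi (n : ℕ) : dual.{u} p :=
  (if n = 0 then 1 else 0) - ∑ k : Fin n, xi p (n - k) ^ p ^ (k : ℕ) * conjXi k
  termination_by n
  decreasing_by exact k.2

lemma conjXi_mem (n : ℕ) : conjXi.{u} p n ∈ (dual.{u} p).deg (coeffDeg p 0 n) := by
  induction n using Nat.strong_induction_on with
  | _ n ih =>
    rw [conjXi]
    refine Submodule.sub_mem _ ?_ (Submodule.sum_mem _ fun k _ => ?_)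
    · split_ifs with h
      · subst h
        simpa [coeffDeg] using SetLike.one_mem_graded (dual.{u} p).deg
      · exact Submodule.zero_mem _
    · have h := SetLike.mul_mem_graded (xi_pow_mem.{u} p (n - k) k) (ih k k.2)
      rwa [add_comm, Elem.coeffDeg_add, Nat.sub_add_cancel k.2.le] at h

/-- The conjugation on generators, with `ι(τ_n) = -∑_{i+j=n} ι(ξ_i)^{p^j} τ_j`. -/
noncomputable def conjGen : Gen.{u} p → dual.{u} p
  | .xi n => conjXi p (n + 1)
  | .tau _ n => -∑ ij ∈ Finset.HasAntidiagonal.antidiagonal n,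
      conjXi p ij.1 ^ p ^ ij.2 * tau p ij.2

lemma conjGen_mem (g : Gen.{u} p) : conjGen p g ∈ (dual.{u} p).deg g.deg := by
  rcases g with n | ⟨h, n⟩
  · have h := conjXi_mem.{u} p (n + 1)
    have h' : coeffDeg p 0 (n + 1) = (Gen.xi n : Gen.{u} p).deg := by simp [coeffDeg, Gen.deg]
    rwa [h'] at h
  · refine Submodule.neg_mem _ (Submodule.sum_mem _ fun ij hij => ?_)
    rw [Finset.HasAntidiagonal.mem_antidiagonal] at hij
    have h1 := SetLike.pow_mem_graded (p ^ ij.2) (conjXi_mem.{u} p ij.1)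
    rw [nsmul_eq_mul] at h1
    have h2 := SetLike.mul_mem_graded h1 (tau_mem.{u} p ij.2)
    rwa [tau_deg_eq p h, hij] at h2

/-- The conjugation `ι : 𝒜_{p*} → 𝒜_{p*}`. -/
noncomputable def conj : dual.{u} p →ₐ[ZMod p] dual.{u} p :=
  DualAlg.liftComm (fun n => (dual.{u} p).deg n) (dual.{u} p).comm (conjGen p) (conjGen_mem p)

/-- `J` is a Hopf ideal of `𝒜_{p*}`: a homogeneous two-sided ideal with
`μ(J) ⊆ J ⊗ 𝒜_{p*} + 𝒜_{p*} ⊗ J` (the two-sided ideal generated by `J ⊗ 1` and `1 ⊗ J`), killed by the counit and stable under the conjugation. -/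
structure IsHopfIdeal (J : TwoSidedIdeal (dual.{u} p)) : Prop where
  homogeneous : ∀ x ∈ J, ∀ i : ℤ, (DirectSum.decompose (dual.{u} p).deg x i : dual.{u} p) ∈ J
  comul_mem : ∀ x ∈ J, comul p x ∈
    TwoSidedIdeal.span {t : Tens (dual.{u} p) | ∃ a ∈ J, t = tens a 1 ∨ t = tens 1 a}
  counit_eq : ∀ x ∈ J, counit p x = 0
  conj_mem : ∀ x ∈ J, conj p x ∈ J

/-- The subalgebra `𝒜_p⟨k⟩_*` of `𝒜_{p*}`, with `𝒜_p⟨0⟩_* = 𝒜_{p*}`: for `k ≥ 1` it is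
generated by the `ξ_n^{p^k}` and, if `p` is odd and `k = 1`, by `τ_0`. -/
noncomputable def subalg (k : ℕ) : Subalgebra (ZMod p) (dual.{u} p) :=
  if k = 0 then ⊤ else Algebra.adjoin (ZMod p)
    {x | (∃ n ≥ 1, x = xi p n ^ p ^ k) ∨ (p ≠ 2 ∧ k = 1 ∧ x = tau p 0)}

/-- The ideal `I_p^⟨k⟩` of `𝒜_p⟨k⟩_*` generated by the `ξ_n^{p^(k+1)}` and, if `p` is odd and
`k = 0`, by `τ_0`. -/
noncomputable def idealI (k : ℕ) : TwoSidedIdeal (subalg.{u} p k) :=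
  TwoSidedIdeal.span {x | (∃ n ≥ 1, (x : dual.{u} p) = xi p n ^ p ^ (k + 1)) ∨
    (p ≠ 2 ∧ k = 0 ∧ (x : dual.{u} p) = tau p 0)}

/-- The extension `J_p^⟨k⟩` of `I_p^⟨k⟩` to `𝒜_{p*}`. -/
noncomputable def idealJ (k : ℕ) : TwoSidedIdeal (dual.{u} p) :=
  TwoSidedIdeal.span {x | ∃ y ∈ idealI p k, x = (y : dual.{u} p)}

variable {p}

/-- `Represents φ α` says that `α ∈ G_p(A)` corresponds to the homomorphism `φ : 𝒜_{p*} → A`, i.e.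
`α = ∑ (φ(ξ_i) + φ(τ_i) ε) X^(p^i)` (without the `τ_i` if `p = 2`). -/
def Represents {A : GrAlg.{u} p} (φ : dual.{u} p ⟶ A) (α : Elem p 0 A) : Prop :=
  ∀ i, coeff (p ^ i) α.1 = ⟨φ.toAlgHom (xi p i), φ.toAlgHom (tau p i)⟩

/-- The closed subscheme of `G_p` defined by an ideal `J` of `𝒜_{p*}`: the elements of `G_p(A)`
that correspond to homomorphisms `𝒜_{p*} → A` vanishing on `J`. -/
def zeroLocus (J : TwoSidedIdeal (dual.{u} p)) (A : GrAlg.{u} p) :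
    Set ((G.{u} p 0).obj A) :=
  {α | ∃ φ : dual.{u} p ⟶ A, Represents φ α ∧ ∀ x ∈ J, φ.toAlgHom x = 0}

end Hopf

/-- `G_p^{ab}`, the kernel of `ρ_0 : G_p → G_p^⟨1⟩`. -/
noncomputable def Gab (p : ℕ) [Fact p.Prime] : SubgroupFunctor (G.{u} p 0) :=
  SubgroupFunctor.ker (rho p 0)

/-- `G_p^{[k]}`, the kernel of `ρ_k : G_p^⟨k⟩ → G_p^⟨k+1⟩`. -/
noncomputable def Gbr (p : ℕ) [Fact p.Prime] (k : ℕ) : GrAlg.{u} p ⥤ GrpCat.{u} :=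
  (SubgroupFunctor.ker (rho p k)).toFunctor

end Steenrod

/-! Everything follows from one description of the filtration: the subgroup scheme cut out by
`idealJ p k` is the kernel of the composite `rhoIter p k` of `ρ_0, …, ρ_k`. This composite raises
every coefficient of index `i ≥ 1` to the power `p^(k+1)`, which also kills its `ε`-part, keeps the
leading coefficient when `k = 0` and replaces it by `1` otherwise (`c_rhoIter`). Its kernel is
therefore given by `ξ_i^(p^(k+1)) = 0` for `i ≥ 1`, together with `τ_0 = 0` when `k = 0`
(`mem_Gt_iff`). The same elements generate the ideal, since extending an ideal from the subalgebra
does not change its generators (`idealJ_eq`); hence `coe_Gt_obj`. Normality, the chain of inclusions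
and the identification of the bottom term with the kernel of `ρ_0` are then formal.

That the ideals are Hopf ideals is checked on generators (`isHopfIdeal_idealJ`). The summands of
`μ(ξ_n)` and `ι(ξ_n)` have degree divisible by `d`, so they commute and the Frobenius is additive on
them. After raising to the power `p^(k+1)`, each summand contains a power of some `ξ_i`, `i ≥ 1`,
that lies in the ideal.

For the quotient, `rhoIter p k` maps the kernel of `rhoIter p (k + 1)` into the kernel of `ρ_(k+1)`,
and the kernel of this restriction is the previous step of the filtration. The target is represented
by a free graded commutative algebra with truncated polynomial generators (`isCorepresentable_Gbr`).
For surjectivity, a preimage of `α` needs `p^(k+1)`-th roots of the coefficients of `α`. These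
coefficients are central, so the roots can be adjoined freely: `A[x_0, x_1, …]/(x_i^N - q_i)` is a
free module on the monomials with exponents below `N`, hence faithfully flat
(`faithfullyFlat_ofBase`, `exists_lift_rhoIter`). -/

namespace Steenrod

open CategoryTheory TensorProduct DirectSum
open PowerSeries

/-! ### The ideals `J_p^⟨k⟩` are Hopf ideals -/

section HopfIdeal

variable {p : ℕ}

/-- Multiplication by a homogeneous element only shifts homogeneous components, so the elements
whose components all lie in `I` form a two-sided ideal `K`; it contains the homogeneous generators.
-/
lemma GrAlg.proj_mem (A : GrAlg.{u} p) {I : TwoSidedIdeal A} {s : Set A} (hs : ∀ x ∈ s, ∃ i, x ∈ A.deg i)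
    (hI : I = TwoSidedIdeal.span s) {x : A} (hx : x ∈ I) (i : ℤ) :
    (decompose A.deg x i : A) ∈ I := by
  let K : TwoSidedIdeal A := TwoSidedIdeal.mk' {x | ∀ i, (decompose A.deg x i : A) ∈ I}
    (fun i => by simp)
    (fun {x y} hx hy i => by simpa using I.add_mem (hx i) (hy i))
    (fun {x} hx i => by
      rw [decompose_neg]
      exact I.neg_mem (hx i))
    (fun {x y} hy => by
      refine Decomposition.inductionOn A.deg (fun i => by simp)
        (fun {j} m i => ?_) (fun a b ha hb i => ?_) x
      · rw [← add_sub_cancel j i, coe_decompose_mul_add_of_left_mem A.deg m.2]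
        exact I.mul_mem_left _ _ (hy _)
      · simpa [add_mul] using I.add_mem (ha i) (hb i))
    (fun {x y} hx => by
      refine Decomposition.inductionOn A.deg (fun i => by simp)
        (fun {j} m i => ?_) (fun a b ha hb i => ?_) y
      · rw [← sub_add_cancel i j, coe_decompose_mul_add_of_right_mem A.deg m.2]
        exact I.mul_mem_right _ _ (hx _)
      · simpa [mul_add] using I.add_mem (ha i) (hb i))
  have h : I ≤ K := by
    conv_lhs => rw [hI]
    refine TwoSidedIdeal.span_le.2 fun x hx => ?_
    obtain ⟨j, hj⟩ := hs x hx
    refine (TwoSidedIdeal.mem_mk' _ _ _ _ _ _ _).2 fun i => ?_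
    by_cases hij : j = i
    · subst hij
      rw [decompose_of_mem_same _ hj, hI]
      exact TwoSidedIdeal.subset_span hx
    · rw [decompose_of_mem_ne _ hj hij]
      exact I.zero_mem
  exact (TwoSidedIdeal.mem_mk' _ _ _ _ _ _ _).1 (h hx) i

lemma tau_of_ne (h : p ≠ 2) (n : ℕ) : tau.{u} p n = DualAlg.gen (.tau h n) := dif_neg h

lemma dvd_pow_mul_coeffDeg (m k i : ℕ) : GrAlg.unitDeg p ∣ (m : ℤ) * coeffDeg p k i :=
  (dvd_mul_right _ _ : GrAlg.unitDeg p ∣ coeffDeg p k i).mul_left _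

variable (p)

/-- The generators of the ideal `J_p^⟨k⟩`. -/
def idealGens (k : ℕ) : Set (dual.{u} p) :=
  {x | (∃ n ≥ 1, x = xi p n ^ p ^ (k + 1)) ∨ (p ≠ 2 ∧ k = 0 ∧ x = tau p 0)}

lemma idealGens_homogeneous (k : ℕ) (x : dual.{u} p) (hx : x ∈ idealGens p k) :
    ∃ i, x ∈ (dual.{u} p).deg i := by
  obtain ⟨n, _, rfl⟩ | ⟨_, _, rfl⟩ := hx
  · exact ⟨_, xi_pow_mem p n (k + 1)⟩
  · exact ⟨_, tau_mem p 0⟩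

variable [Fact p.Prime]

lemma idealGens_subset_subalg (k : ℕ) : idealGens.{u} p k ⊆ subalg p k := by
  intro x hx
  rw [subalg]
  split_ifs with hk
  · trivial
  · obtain ⟨n, hn, rfl⟩ | ⟨_, h, _⟩ := hx
    · rw [pow_succ, pow_mul]
      refine SetLike.mem_coe.2 (pow_mem (Algebra.subset_adjoin ?_) p)
      exact Or.inl ⟨n, hn, rfl⟩
    · exact absurd h hk

/-- The contraction to the subalgebra of the ideal spanned in `𝒜_{p*}` already contains the
generators of `I_p^⟨k⟩`, hence all of it. -/
lemma idealJ_eq (k : ℕ) : idealJ.{u} p k = TwoSidedIdeal.span (idealGens p k) := by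
  refine le_antisymm (TwoSidedIdeal.span_le.2 ?_) (TwoSidedIdeal.span_mono fun x hx => ?_)
  · rintro _ ⟨y, hy, rfl⟩
    have h : idealI.{u} p k ≤
        (TwoSidedIdeal.span (idealGens p k)).comap (subalg.{u} p k).val :=
      TwoSidedIdeal.span_le.2 fun z hz => (TwoSidedIdeal.mem_comap (subalg.{u} p k).val).2
        (TwoSidedIdeal.subset_span hz)
    exact (TwoSidedIdeal.mem_comap (subalg.{u} p k).val).1 (h hy)
  · exact ⟨⟨x, idealGens_subset_subalg p k hx⟩, TwoSidedIdeal.subset_span hx, rfl⟩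

variable {p}

/-- Reduces every containment about `J_p^⟨k⟩` to its generators. It serves the coproduct, the
counit, the conjugation and the homomorphisms into a test algebra. -/
lemma idealJ_le_comap {k : ℕ} {C : Type v} [Ring C] [Algebra (ZMod p) C]
    (f : dual.{u} p →ₐ[ZMod p] C) (I : TwoSidedIdeal C)
    (hxi : ∀ n, 1 ≤ n → f (xi p n) ^ p ^ (k + 1) ∈ I)
    (htau : p ≠ 2 → k = 0 → f (tau p 0) ∈ I) {x : dual.{u} p} (hx : x ∈ idealJ p k) :
    f x ∈ I := by
  have h : idealJ.{u} p k ≤ I.comap f := by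
    rw [idealJ_eq]
    refine TwoSidedIdeal.span_le.2 fun x hx => (TwoSidedIdeal.mem_comap f).2 ?_
    obtain ⟨n, hn, rfl⟩ | ⟨h1, h2, rfl⟩ := hx
    · rw [map_pow]
      exact hxi n hn
    · exact htau h1 h2
  exact (TwoSidedIdeal.mem_comap f).1 (h hx)

lemma xi_pow_mem_idealJ {k n m : ℕ} (hn : 1 ≤ n) (hm : k + 1 ≤ m) :
    xi.{u} p n ^ p ^ m ∈ idealJ p k := by
  obtain ⟨l, rfl⟩ := Nat.exists_eq_add_of_le hm
  -- The exponent is written as a successor so that one factor `ξ_n^(p^(k+1))`, a generator, splits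
  -- off.
  have hN : p ^ l = p ^ l - 1 + 1 :=
    (Nat.sub_add_cancel (pow_pos (Fact.out : p.Prime).pos l)).symm
  rw [pow_add, pow_mul, idealJ_eq, hN, pow_succ]
  exact TwoSidedIdeal.mul_mem_left _ _ _ (TwoSidedIdeal.subset_span (Or.inl ⟨n, hn, rfl⟩))

/-- The Koszul sign disappears: the degree of `b` is even for odd `p`, and signs are trivial for `p
= 2`. -/
lemma tens_mul_of_dvd {A : GrAlg.{u} p} {j k : ℤ} (a : A) {b c : A} (d : A)
    (hb : b ∈ A.deg j) (hc : c ∈ A.deg k) (h : GrAlg.unitDeg p ∣ j) :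
    tens a b * tens c d = tens (a * c) (b * d) := by
  rw [tens_mul a d hb hc]
  exact GrAlg.negOnePow_smul (M := A.carrier ⊗[ZMod p] A.carrier) (h.mul_right k) _

lemma tens_pow {A : GrAlg.{u} p} {i j : ℤ} {a b : A}
    (ha : a ∈ A.deg i) (hb : b ∈ A.deg j) (h : GrAlg.unitDeg p ∣ j) (m : ℕ) :
    tens a b ^ m = tens (a ^ m) (b ^ m) := by
  induction m with
  | zero => simp only [pow_zero]; rfl
  | succ m ih =>
    have h1 := SetLike.pow_mem_graded m hb
    rw [pow_succ, ih, tens_mul_of_dvd _ _ h1 ha (by rw [nsmul_eq_mul]; exact h.mul_left _), pow_succ, pow_succ]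

lemma tens_natCast_eq_zero (A : GrAlg.{u} p) : (p : Tens A) = 0 := by
  rw [← map_natCast (algebraMap (ZMod p) (Tens A)), ZMod.natCast_self, map_zero]

lemma tensDeg_commute {A : GrAlg.{u} p} {m n : ℤ} {x y : Tens A} (hx : x ∈ tensDeg A m)
    (hy : y ∈ tensDeg A n) (h : GrAlg.unitDeg p ∣ m) : Commute x y :=
  (tensDeg_comm A hx hy).trans
    (GrAlg.negOnePow_smul (M := A.carrier ⊗[ZMod p] A.carrier) (h.mul_right n) _)

/-- `a ⊗ b = (a ⊗ 1)(1 ⊗ b)` without sign, the inner factors being `1`, of degree `0`. -/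
lemma tens_mem_span {A : GrAlg.{u} p} {J : TwoSidedIdeal A} {a b : A} (h : a ∈ J ∨ b ∈ J) :
    tens a b ∈ TwoSidedIdeal.span {t : Tens A | ∃ a ∈ J, t = tens a 1 ∨ t = tens 1 a} := by
  have h1 : (1 : A) ∈ A.deg 0 := SetLike.one_mem_graded A.deg
  have e : tens a b = tens a 1 * tens 1 b := by
    rw [tens_mul_of_dvd a b h1 h1 (dvd_zero _), mul_one, one_mul]
  rw [e]
  obtain h | h := h
  · exact TwoSidedIdeal.mul_mem_right _ _ _ (TwoSidedIdeal.subset_span ⟨a, h, Or.inl rfl⟩)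
  · exact TwoSidedIdeal.mul_mem_left _ _ _ (TwoSidedIdeal.subset_span ⟨b, h, Or.inr rfl⟩)

lemma comul_xi {n : ℕ} (hn : 1 ≤ n) : comul p (xi.{u} p n) =
    ∑ ij ∈ Finset.HasAntidiagonal.antidiagonal n, tens (xi p ij.1 ^ p ^ ij.2) (xi p ij.2) := by
  obtain ⟨n, rfl⟩ := Nat.exists_eq_add_of_le' hn
  exact DualAlg.liftComm_gen _ (tensDeg_comm _) _ _ _

lemma comul_tau_zero (h : p ≠ 2) :
    comul p (tau.{u} p 0) = tens 1 (tau p 0) + tens (tau p 0) 1 := by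
  rw [tau_of_ne h]
  refine (DualAlg.liftComm_gen _ (tensDeg_comm _) _ _ _).trans ?_
  rw [comulGen, Finset.Nat.antidiagonal_zero, Finset.sum_singleton, tau_of_ne h,
    show xi.{u} p 0 ^ p ^ 0 = 1 from one_pow _]

/-- By additivity of the Frobenius the power is the sum of the `ξ_i^(p^(j+k+1)) ⊗ ξ_j^(p^(k+1))`
with `i + j = n`. As `n ≥ 1`, at least one index is positive, and the corresponding factor lies in
`J_p^⟨k⟩`. -/
lemma comul_xi_pow_mem {k n : ℕ} (hn : 1 ≤ n) : comul p (xi.{u} p n) ^ p ^ (k + 1) ∈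
    TwoSidedIdeal.span
      {t : Tens (dual.{u} p) | ∃ a ∈ idealJ p k, t = tens a 1 ∨ t = tens 1 a} := by
  rw [comul_xi hn, sum_pow_of_commute (tens_natCast_eq_zero _)]
  · refine TwoSidedIdeal.finsetSum_mem _ _ _ fun ij hij => ?_
    rw [Finset.HasAntidiagonal.mem_antidiagonal] at hij
    rw [tens_pow (xi_pow_mem p _ _) (xi_mem p _) (Elem.dvd_coeffDeg p 0 _), ← pow_mul, ← pow_add]
    refine tens_mem_span ?_
    by_cases hi : 1 ≤ ij.1
    · exact Or.inl (xi_pow_mem_idealJ hi (by omega))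
    · exact Or.inr (xi_pow_mem_idealJ (by omega) le_rfl)
  -- The summands commute because their total degree is a multiple of `d`.
  · intro a _ b _
    exact tensDeg_commute (tens_mem (xi_pow_mem p _ _) (xi_mem p _) rfl)
      (tens_mem (xi_pow_mem p _ _) (xi_mem p _) rfl)
      (dvd_add (dvd_pow_mul_coeffDeg _ _ _) (Elem.dvd_coeffDeg p 0 _))

lemma conj_xi {n : ℕ} (hn : 1 ≤ n) : conj p (xi.{u} p n) = conjXi p n := by
  obtain ⟨n, rfl⟩ := Nat.exists_eq_add_of_le' hn
  exact DualAlg.liftComm_gen _ (dual.{u} p).comm _ _ _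

lemma conj_tau_zero (h : p ≠ 2) : conj p (tau.{u} p 0) = -(conjXi p 0 * tau p 0) := by
  rw [tau_of_ne h]
  refine (DualAlg.liftComm_gen _ (dual.{u} p).comm _ _ _).trans ?_
  rw [conjGen, Finset.Nat.antidiagonal_zero, Finset.sum_singleton, tau_of_ne h, pow_zero, pow_one]

/-- In `ι(ξ_n) = -∑_{l<n} ξ_{n-l}^(p^l) ι(ξ_l)` every term has a factor `ξ_{n-l}` with `n - l ≥ 1`.
Its power lies in the ideal, so nothing is needed about `ι(ξ_l)` and no induction occurs. -/
lemma conj_xi_pow_mem {k n : ℕ} (hn : 1 ≤ n) :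
    conj p (xi.{u} p n) ^ p ^ (k + 1) ∈ idealJ.{u} p k := by
  have hmem : ∀ l : Fin n, xi.{u} p (n - l) ^ p ^ (l : ℕ) * conjXi p l ∈
      (dual.{u} p).deg (coeffDeg p 0 n) := fun l => by
    have h := SetLike.mul_mem_graded (xi_pow_mem.{u} p (n - l) l) (conjXi_mem p l)
    rwa [add_comm, Elem.coeffDeg_add, Nat.sub_add_cancel l.2.le] at h
  have e : conjXi.{u} p n = ∑ l : Fin n, -(xi p (n - l) ^ p ^ (l : ℕ) * conjXi p l) := by
    conv_lhs => rw [conjXi]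
    rw [if_neg (by omega), zero_sub, Finset.sum_neg_distrib]
  rw [conj_xi hn, e, sum_pow_of_commute (dual.{u} p).natCast_eq_zero]
  · refine TwoSidedIdeal.finsetSum_mem _ _ _ fun l _ => ?_
    rw [neg_pow, ((dual.{u} p).commute_of_dvd (dvd_pow_mul_coeffDeg _ 0 _) (xi_pow_mem p _ _)
      (conjXi_mem p _)).mul_pow, ← pow_mul, ← pow_add]
    exact TwoSidedIdeal.mul_mem_left _ _ _ (TwoSidedIdeal.mul_mem_right _ _ _
      (xi_pow_mem_idealJ (by omega) (by omega)))
  · intro a _ b _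
    exact (dual.{u} p).commute_of_dvd (Elem.dvd_coeffDeg p 0 n)
      (Submodule.neg_mem _ (hmem a)) (Submodule.neg_mem _ (hmem b))

theorem isHopfIdeal_idealJ (k : ℕ) : IsHopfIdeal p (idealJ.{u} p k) where
  homogeneous _ hx i := (dual.{u} p).proj_mem (idealGens_homogeneous p k) (idealJ_eq p k) hx i
  comul_mem _ hx := idealJ_le_comap (comul p) _ (fun _ hn => comul_xi_pow_mem hn)
    (fun h hk => by
      have ht : tau.{u} p 0 ∈ idealJ.{u} p k := by
        rw [idealJ_eq]
        exact TwoSidedIdeal.subset_span (Or.inr ⟨h, hk, rfl⟩)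
      rw [comul_tau_zero h]
      exact TwoSidedIdeal.add_mem _ (tens_mem_span (Or.inr ht))
        (tens_mem_span (Or.inl ht))) hx
  -- Vanishing is membership in the zero ideal of `𝔽_p`, which puts it in the scope of the test on
  -- generators.
  counit_eq _ hx := (TwoSidedIdeal.mem_bot _).1 <| idealJ_le_comap (counit p) ⊥
    (fun n hn => by
      obtain ⟨n, rfl⟩ := Nat.exists_eq_add_of_le' hn
      have h : counit p (xi.{u} p (n + 1)) = 0 := DualAlg.lift_gen _ _ _ _ _
      rw [h, zero_pow (pow_ne_zero _ (Fact.out : p.Prime).ne_zero)]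
      exact TwoSidedIdeal.zero_mem _)
    (fun h _ => by
      have h : counit p (tau.{u} p 0) = 0 := by
        rw [tau_of_ne h]
        exact DualAlg.lift_gen _ _ _ _ _
      rw [h]
      exact TwoSidedIdeal.zero_mem _) hx
  conj_mem _ hx := idealJ_le_comap (conj p) _ (fun _ hn => conj_xi_pow_mem hn)
    (fun h hk => by
      rw [conj_tau_zero h]
      refine TwoSidedIdeal.neg_mem _ (TwoSidedIdeal.mul_mem_left _ _ _ ?_)
      rw [idealJ_eq]
      exact TwoSidedIdeal.subset_span (Or.inr ⟨h, hk, rfl⟩)) hx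

end HopfIdeal

/-! ### The filtration as kernels of iterated Frobenius maps -/

section Kernels

variable {p : ℕ}

/-- A homomorphism of group functors restricts to a homomorphism from the kernel of a composite. -/
def SubgroupFunctor.kerRestrict {F F' F'' : GrAlg.{u} p ⥤ GrpCat.{u}} (φ : F ⟶ F') (ψ : F' ⟶ F'') :
    (ker (φ ≫ ψ)).toFunctor ⟶ (ker ψ).toFunctor where
  app A := GrpCat.ofHom (((φ.app A).hom.comp ((ker (φ ≫ ψ)).obj A).subtype).codRestrict
    ((ker ψ).obj A) fun g => g.2)
  naturality A B f := by
    refine GrpCat.hom_ext (MonoidHom.ext fun g => Subtype.ext ?_)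
    exact NatTrans.naturality_apply φ f g.1

lemma SubgroupFunctor.isNormal_ker {F F' : GrAlg.{u} p ⥤ GrpCat.{u}} (φ : F ⟶ F') :
    (ker φ).IsNormal := fun A => MonoidHom.normal_ker (φ.app A).hom

variable (p) [Fact p.Prime]

/-- The composite `ρ_k ∘ ⋯ ∘ ρ_0 : G_p → G_p^⟨k+1⟩`. -/
noncomputable def rhoIter : ∀ k : ℕ, G.{u} p 0 ⟶ G.{u} p (k + 1)
  | 0 => rho p 0
  | k + 1 => rhoIter k ≫ rho p (k + 1)

/-- The subgroup functor `G̃_p^⟨k⟩`. -/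
noncomputable def Gt (k : ℕ) : SubgroupFunctor (G.{u} p 0) := SubgroupFunctor.ker (rhoIter p k)

variable {p}

/-- `ρ_0` keeps the leading coefficient and every later `ρ` resets it to `1`; each of the `k + 1`
maps contributes one `p`-th power to the other coefficients. -/
lemma c_rhoIter (k : ℕ) {A : GrAlg.{u} p} (α : Elem p 0 A) (i : ℕ) :
    Elem.c (((rhoIter p k).app A).hom α : Elem p (k + 1) A) i =
      if i = 0 then (if k = 0 then α.c 0 else 1) else α.c i ^ p ^ (k + 1) := by
  induction k with
  | zero =>
    refine (Elem.c_rho α i).trans ?_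
    rw [zero_add, pow_one]
  | succ k ih =>
    refine (Elem.c_rho (k := k + 1) _ i).trans ?_
    erw [ih]
    by_cases hi : i = 0
    · simp [hi]
    · simp only [if_neg hi]
      rw [← pow_mul, ← pow_succ]

lemma Gt_le (k : ℕ) : Gt.{u} p k ≤ Gt p (k + 1) := fun A α hα => by
  have h : ((rhoIter p k).app A).hom α = 1 := hα
  refine MonoidHom.mem_ker.2 ?_
  exact (congrArg ((rho p (k + 1)).app A).hom h).trans (map_one _)

/-- No condition falls on the `ε`-parts of index `i ≥ 1`, because `p`-th powers kill them. The
`ε`-part of the leading coefficient is seen only by `ρ_0` alone, that is for `k = 0`. -/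
lemma mem_Gt_iff (k : ℕ) {A : GrAlg.{u} p} (α : Elem p 0 A) :
    α ∈ (Gt p k).obj A ↔
      (∀ i, 1 ≤ i → (α.c i).re ^ p ^ (k + 1) = 0) ∧ (k = 0 → (α.c 0).im = 0) := by
  have h0 : α ∈ (Gt p k).obj A ↔ (((rhoIter p k).app A).hom α : Elem p (k + 1) A) = 1 :=
    Iff.rfl
  rw [h0]
  constructor
  · intro h
    have hc := fun i => (c_rhoIter k α i).symm.trans
      ((congrArg (fun β : Elem p (k + 1) A => β.c i) h).trans (Elem.c_one i))
    refine ⟨fun i hi => ?_, fun hk => ?_⟩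
    · have := hc i
      rw [if_neg (by omega), if_neg (by omega)] at this
      rw [← Eps.re_pow, this]
      rfl
    · have := hc 0
      rw [if_pos rfl, if_pos hk, if_pos rfl] at this
      rw [this]
      rfl
  · rintro ⟨h1, h2⟩
    have h3 : ∀ i, Elem.c (1 : Elem p (k + 1) A) i = if i = 0 then 1 else 0 := Elem.c_one
    refine Elem.ext (fun i => ?_) (fun i hi => ?_)
    · refine (congrArg Eps.re (c_rhoIter k α i)).trans (Eq.trans ?_ (congrArg Eps.re (h3 i).symm))
      split_ifs with hi hk
      · exact α.re_zero
      · rfl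
      · rw [Eps.re_pow, h1 i (by omega)]
        rfl
    · refine (congrArg Eps.im (c_rhoIter k α i)).trans (Eq.trans ?_ (congrArg Eps.im (h3 i).symm))
      split_ifs with hi hk
      · exact h2 hk
      · rfl
      · exact Eps.im_pow_p (α.deg i) (Elem.dvd_coeffDeg p 0 i) k

/-- The values on generators of the homomorphism `𝒜_{p*} → A` that corresponds to `α ∈ G_p(A)`. -/
noncomputable def genVal {A : GrAlg.{u} p} (α : Elem p 0 A) : Gen.{u} p → A
  | .xi n => (α.c (n + 1)).re
  | .tau _ n => (α.c n).im

lemma genVal_mem {A : GrAlg.{u} p} (α : Elem p 0 A) (g : Gen.{u} p) : genVal α g ∈ A.deg g.deg := by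
  rcases g with n | ⟨h, n⟩
  · have h := (α.deg (n + 1)).1
    simpa [coeffDeg, Gen.deg, genVal] using h
  · have h1 := (α.deg n).2
    have e : coeffDeg p 0 n + 1 = (Gen.tau h n : Gen.{u} p).deg := by
      simp only [coeffDeg, Gen.deg, GrAlg.unitDeg, if_neg h, add_zero, pow_zero]
      ring
    rwa [e] at h1

/-- The values `α_i` have the degrees of the generators, and the relations of `𝒜_{p*}` hold for such
values in every graded commutative algebra. Preservation of degree is tested on monomials, which
span the homogeneous parts. -/
lemma exists_represents {A : GrAlg.{u} p} (α : Elem p 0 A) :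
    ∃ φ : dual.{u} p ⟶ A, Represents φ α := by
  let f : DualAlg.{u} p →ₐ[ZMod p] A :=
    DualAlg.liftComm (fun n => A.deg n) A.comm (genVal α) (genVal_mem α)
  have hf : ∀ g, f (DualAlg.gen g) = genVal α g := DualAlg.liftComm_gen _ A.comm _ _
  have hmon : ∀ l : List (Gen.{u} p), f (DualAlg.mon l) ∈ A.deg (DualAlg.monDeg l) := by
    intro l
    induction l with
    | nil => simpa [DualAlg.mon, DualAlg.monDeg] using SetLike.one_mem_graded A.deg
    | cons g l ih =>
      have h := SetLike.mul_mem_graded (genVal_mem α g) ih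
      rw [← hf, ← map_mul] at h
      simpa [DualAlg.mon, DualAlg.monDeg] using h
  let φ : dual.{u} p ⟶ A := ⟨f, fun {i a} ha => by
    have h : DualAlg.deg.{u} p i ≤ (A.deg i).comap f.toLinearMap :=
      Submodule.span_le.2 (by
        rintro _ ⟨l, rfl, rfl⟩
        exact hmon l)
    exact h ha⟩
  refine ⟨φ, fun i => Eps.ext ?_ ?_⟩
  · cases i with
    | zero => exact α.re_zero.trans (map_one f).symm
    | succ n => exact (hf (.xi n)).symm
  · by_cases h : p = 2
    · have e : tau.{u} p i = (0 : DualAlg.{u} p) := dif_pos h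
      rw [α.2.eps i fun h' => h'.1 h, e]
      exact (map_zero f).symm
    · rw [tau_of_ne h]
      exact (hf (.tau h i)).symm

/-- Under the correspondence `α_i = φ(ξ_i) + φ(τ_i) ε`, the equations of `mem_Gt_iff` say that `φ`
kills the generators of `J_p^⟨k⟩`. -/
theorem coe_Gt_obj (k : ℕ) (A : GrAlg.{u} p) :
    ((Gt p k).obj A : Set ((G.{u} p 0).obj A)) = zeroLocus (idealJ.{u} p k) A := by
  refine Set.ext fun (α : Elem p 0 A) => ?_
  have hc : ∀ φ : dual.{u} p ⟶ A, Represents φ α →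
      ∀ i, α.c i = ⟨φ.toAlgHom (xi p i), φ.toAlgHom (tau p i)⟩ := fun _ h => h
  refine (mem_Gt_iff k α).trans ⟨fun ⟨h1, h2⟩ => ?_, ?_⟩
  · obtain ⟨φ, hφ⟩ := exists_represents α
    refine ⟨φ, hφ, fun x hx => (TwoSidedIdeal.mem_bot _).1 <|
      idealJ_le_comap φ.toAlgHom ⊥ (fun n hn => ?_) (fun _ hk => ?_) hx⟩
    · rw [TwoSidedIdeal.mem_bot, ← h1 n hn, hc φ hφ n]
    · rw [TwoSidedIdeal.mem_bot, ← h2 hk, hc φ hφ 0]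
  · rintro ⟨φ, hφ, hJ⟩
    refine ⟨fun i hi => ?_, fun hk => ?_⟩
    · rw [hc φ hφ i]
      exact (map_pow φ.toAlgHom _ _).symm.trans (hJ _ (xi_pow_mem_idealJ hi le_rfl))
    · rw [hc φ hφ 0]
      -- For `p = 2` the element `τ_0` is `0` by convention and is not among the generators of the
      -- ideal, so the equation holds for a different reason.
      by_cases h : p = 2
      · have e : tau.{u} p 0 = (0 : DualAlg.{u} p) := dif_pos h
        rw [e]
        exact map_zero φ.toAlgHom
      · refine hJ _ ?_
        rw [idealJ_eq]
        exact TwoSidedIdeal.subset_span (Or.inr ⟨h, hk, rfl⟩)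

end Kernels

/-! ### Free graded commutative algebras with truncated generators -/

section Truncated

/-- The relations of the graded commutative algebra on generators `g` of degree `δ g`, in which the
`p`-th powers of the generators in `T` vanish. -/
inductive TruncRel (p : ℕ) {Γ : Type u} (δ : Γ → ℤ) (T : Set Γ) :
    FreeAlgebra (ZMod p) Γ → FreeAlgebra (ZMod p) Γ → Prop
  | comm (g g' : Γ) : TruncRel p δ T (FreeAlgebra.ι (ZMod p) g * FreeAlgebra.ι (ZMod p) g')
      (((δ g * δ g').negOnePow : ℤ) • (FreeAlgebra.ι (ZMod p) g' * FreeAlgebra.ι (ZMod p) g))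
  | trunc (g : Γ) (h : g ∈ T) : TruncRel p δ T (FreeAlgebra.ι (ZMod p) g ^ p) 0

/-- The algebra underlying the truncated free graded commutative algebra. -/
def TruncAlg (p : ℕ) {Γ : Type u} (δ : Γ → ℤ) (T : Set Γ) : Type u := RingQuot (TruncRel p δ T)

namespace TruncAlg

variable {p : ℕ} {Γ : Type u} {δ : Γ → ℤ} {T : Set Γ}

instance : Ring (TruncAlg p δ T) := inferInstanceAs (Ring (RingQuot (TruncRel p δ T)))

instance : Algebra (ZMod p) (TruncAlg p δ T) :=
  inferInstanceAs (Algebra (ZMod p) (RingQuot (TruncRel p δ T)))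

/-- The quotient map from the free algebra. -/
noncomputable def mk (p : ℕ) (δ : Γ → ℤ) (T : Set Γ) :
    FreeAlgebra (ZMod p) Γ →ₐ[ZMod p] TruncAlg p δ T :=
  RingQuot.mkAlgHom (ZMod p) (TruncRel p δ T)

/-- The class of a generator. -/
noncomputable def gen (p : ℕ) (δ : Γ → ℤ) (T : Set Γ) (g : Γ) : TruncAlg p δ T :=
  mk p δ T (FreeAlgebra.ι (ZMod p) g)

/-- Algebra homomorphisms defined on generators. -/
noncomputable def lift {C : Type v} [Ring C] [Algebra (ZMod p) C] (f : Γ → C)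
    (h1 : ∀ g g', f g * f g' = ((δ g * δ g').negOnePow : ℤ) • (f g' * f g))
    (h2 : ∀ g ∈ T, f g ^ p = 0) : TruncAlg p δ T →ₐ[ZMod p] C :=
  RingQuot.liftAlgHom (ZMod p) ⟨FreeAlgebra.lift (ZMod p) f, by
    intro x y h
    induction h with
    | comm g g' => simpa [map_zsmul] using h1 g g'
    | trunc g h => simpa using h2 g h⟩

@[simp] lemma lift_gen {C : Type v} [Ring C] [Algebra (ZMod p) C] (f : Γ → C)
    (h1 : ∀ g g', f g * f g' = ((δ g * δ g').negOnePow : ℤ) • (f g' * f g))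
    (h2 : ∀ g ∈ T, f g ^ p = 0) (g : Γ) : lift f h1 h2 (gen p δ T g) = f g :=
  (RingQuot.liftAlgHom_mkAlgHom_apply _ _ _ _).trans (FreeAlgebra.lift_ι_apply _ _)

lemma algHom_ext {C : Type v} [Ring C] [Algebra (ZMod p) C] {f f' : TruncAlg p δ T →ₐ[ZMod p] C}
    (h : ∀ g, f (gen p δ T g) = f' (gen p δ T g)) : f = f' := by
  apply RingQuot.ringQuot_ext'
  apply FreeAlgebra.hom_ext
  funext g
  exact h g

lemma gen_comm (g g' : Γ) : gen p δ T g * gen p δ T g' =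
    ((δ g * δ g').negOnePow : ℤ) • (gen p δ T g' * gen p δ T g) := by
  simp only [gen, ← map_mul, ← map_zsmul]
  exact RingQuot.mkAlgHom_rel _ (TruncRel.comm g g')

lemma gen_pow (g : Γ) (h : g ∈ T) : gen p δ T g ^ p = 0 := by
  rw [gen, ← map_pow, ← map_zero (mk p δ T)]
  exact RingQuot.mkAlgHom_rel _ (TruncRel.trunc g h)

/-- The monomial with the given list of factors. -/
noncomputable def mon (p : ℕ) (δ : Γ → ℤ) (T : Set Γ) (l : List Γ) : TruncAlg p δ T :=
  (l.map (gen p δ T)).prod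

lemma mon_cons (g : Γ) (l : List Γ) : mon p δ T (g :: l) = gen p δ T g * mon p δ T l := by
  simp [mon]

/-- The homogeneous elements of degree `n`: the span of the monomials of degree `n`. -/
noncomputable def deg (p : ℕ) (δ : Γ → ℤ) (T : Set Γ) (n : ℤ) :
    Submodule (ZMod p) (TruncAlg p δ T) :=
  Submodule.span (ZMod p) {x | ∃ l : List Γ, (l.map δ).sum = n ∧ mon p δ T l = x}

lemma mon_mem (l : List Γ) : mon p δ T l ∈ deg p δ T (l.map δ).sum :=
  Submodule.subset_span ⟨l, rfl, rfl⟩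

lemma gen_mem (g : Γ) : gen p δ T g ∈ deg p δ T (δ g) := by
  simpa [mon] using mon_mem (p := p) (δ := δ) (T := T) [g]

instance : SetLike.GradedMonoid (deg p δ T) where
  one_mem := mon_mem []
  mul_mem := by
    intro i j a b ha hb
    induction ha using Submodule.span_induction with
    | mem x hx =>
      obtain ⟨l, rfl, rfl⟩ := hx
      induction hb using Submodule.span_induction with
      | mem y hy =>
        obtain ⟨m, rfl, rfl⟩ := hy
        simpa [mon] using mon_mem (p := p) (δ := δ) (T := T) (l ++ m)
      | zero => simp
      | add y z _ _ h1 h2 => rw [mul_add]; exact Submodule.add_mem _ h1 h2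
      | smul r y _ h => rw [mul_smul_comm]; exact Submodule.smul_mem _ _ h
    | zero => simp
    | add y z _ _ h1 h2 => rw [add_mul]; exact Submodule.add_mem _ h1 h2
    | smul r y _ h => rw [smul_mul_assoc]; exact Submodule.smul_mem _ _ h

lemma of_congr {i j : ℤ} {x : deg p δ T i} {y : deg p δ T j} (h : i = j)
    (h' : (x : TruncAlg p δ T) = y) :
    DirectSum.of (fun i => deg p δ T i) i x = DirectSum.of (fun i => deg p δ T i) j y := by
  subst h
  rw [Subtype.ext h']

/-- The decomposition into homogeneous components. -/
noncomputable def dec (p : ℕ) (δ : Γ → ℤ) (T : Set Γ) :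
    TruncAlg p δ T →ₐ[ZMod p] ⨁ i, deg p δ T i :=
  lift (fun g => DirectSum.of (fun i => deg p δ T i) (δ g) ⟨gen p δ T g, gen_mem g⟩)
    (fun g g' => by
      have hg := gen_comm (p := p) (δ := δ) (T := T) g g'
      rw [DirectSum.of_mul_of, DirectSum.of_mul_of]
      rcases Int.units_eq_one_or (δ g * δ g').negOnePow with h | h
      · rw [h, Units.val_one, one_smul] at hg ⊢
        exact of_congr (add_comm _ _) hg
      · rw [h, Units.val_neg, Units.val_one] at hg ⊢
        rw [neg_smul, one_smul] at hg
        refine Eq.trans ?_ (neg_one_zsmul (DirectSum.of (fun i => deg p δ T i) (δ g' + δ g) _)).symm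
        refine Eq.trans ?_ (map_neg (DirectSum.of (fun i => deg p δ T i) (δ g' + δ g)) _)
        exact of_congr (add_comm _ _) hg)
    (fun g h => by
      rw [DirectSum.ofPow, ← map_zero (DirectSum.of (fun i => deg p δ T i) (p • δ g))]
      exact of_congr rfl (gen_pow g h))

lemma dec_gen (g : Γ) : dec p δ T (gen p δ T g) =
    DirectSum.of (fun i => deg p δ T i) (δ g) ⟨gen p δ T g, gen_mem g⟩ := by
  rw [dec, lift_gen]

lemma dec_mon (l : List Γ) : dec p δ T (mon p δ T l) =
    DirectSum.of (fun i => deg p δ T i) (l.map δ).sum ⟨mon p δ T l, mon_mem l⟩ := by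
  induction l with
  | nil => exact (map_one _).trans (of_congr rfl rfl)
  | cons g l ih =>
    refine (congrArg _ (mon_cons g l)).trans ?_
    rw [map_mul, ih, dec_gen, DirectSum.of_mul_of]
    exact of_congr (by simp) (mon_cons g l).symm

noncomputable instance : GradedAlgebra (deg p δ T) :=
  GradedAlgebra.ofAlgHom _ (dec p δ T)
    (algHom_ext fun g => by simp [dec_gen])
    (fun i x => by
      obtain ⟨x, hx⟩ := x
      induction hx using Submodule.span_induction with
      | mem x hx =>
        obtain ⟨l, rfl, rfl⟩ := hx
        exact dec_mon l
      | zero => exact (map_zero _).trans (map_zero _).symm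
      | add x y hx hy h1 h2 =>
        simp only at h1 h2
        rw [map_add, h1, h2, ← map_add]
        rfl
      | smul r x hx h =>
        simp only at h
        rw [map_smul, h, ← DirectSum.lof_eq_of (ZMod p), ← map_smul]
        rfl)

lemma comm_mon (x : TruncAlg p δ T) (i : ℤ)
    (hx : ∀ g, x * gen p δ T g = (i * δ g).negOnePow • (gen p δ T g * x)) (l : List Γ) :
    x * mon p δ T l = (i * (l.map δ).sum).negOnePow • (mon p δ T l * x) := by
  induction l with
  | nil => simp [mon]
  | cons g l ih =>
    rw [mon_cons, List.map_cons, List.sum_cons, mul_add, Int.negOnePow_add, ← mul_assoc, hx,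
      smul_mul_assoc, mul_assoc, ih, mul_smul_comm, smul_smul, mul_assoc]

lemma graded_comm {i j : ℤ} {a b : TruncAlg p δ T} (ha : a ∈ deg p δ T i) (hb : b ∈ deg p δ T j) :
    a * b = (i * j).negOnePow • (b * a) := by
  induction ha using Submodule.span_induction with
  | mem x hx =>
    obtain ⟨l, rfl, rfl⟩ := hx
    induction hb using Submodule.span_induction with
    | mem y hy =>
      obtain ⟨m, rfl, rfl⟩ := hy
      refine comm_mon _ _ (fun g => ?_) m
      -- `comm_mon` extends a relation from generators to monomials in its second factor only.
      -- Exchanging the sides, which is harmless as a sign is its own inverse, lets it be used for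
      -- the first factor too.
      refine DualAlg.smul_swap _ ?_
      rw [mul_comm]
      exact comm_mon _ _ (gen_comm g) l
    | zero => simp
    | add y z _ _ h1 h2 => rw [mul_add, h1, h2, add_mul, smul_add]
    | smul r y _ h => rw [mul_smul_comm, h, smul_mul_assoc, smul_comm]
  | zero => simp
  | add y z _ _ h1 h2 => rw [add_mul, h1, h2, mul_add, smul_add]
  | smul r y _ h => rw [smul_mul_assoc, h, mul_smul_comm, smul_comm]

/-- The truncated free graded commutative algebra. -/
noncomputable def grAlg (p : ℕ) (δ : Γ → ℤ) (T : Set Γ) : GrAlg.{u} p where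
  carrier := TruncAlg p δ T
  deg := deg p δ T
  comm := graded_comm

/-- Commutation up to sign holds in every target, so the only conditions are on degrees and `p`-th
powers. For odd `p` the relation `g² = -g²` already makes a generator of odd degree exterior. -/
lemma exists_hom {A : GrAlg.{u} p} (f : Γ → A) (hf : ∀ g, f g ∈ A.deg (δ g))
    (hT : ∀ g ∈ T, f g ^ p = 0) :
    ∃ φ : grAlg p δ T ⟶ A, ∀ g, φ.toAlgHom (gen p δ T g) = f g := by
  let F : TruncAlg p δ T →ₐ[ZMod p] A := lift f (fun g g' => A.comm (hf g) (hf g')) hT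
  have hF : ∀ g, F (gen p δ T g) = f g := fun g => lift_gen f _ _ g
  have hmon : ∀ l : List Γ, F (mon p δ T l) ∈ A.deg (l.map δ).sum := by
    intro l
    induction l with
    | nil => simpa [mon] using SetLike.one_mem_graded A.deg
    | cons g l ih =>
      have h := SetLike.mul_mem_graded (hf g) ih
      rw [← hF, ← map_mul] at h
      simpa [mon] using h
  refine ⟨⟨F, fun {i a} ha => ?_⟩, hF⟩
  have h : deg p δ T i ≤ (A.deg i).comap F.toLinearMap :=
    Submodule.span_le.2 (by
      rintro _ ⟨l, rfl, rfl⟩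
      exact hmon l)
  exact h ha

lemma hom_ext {A : GrAlg.{u} p} {φ ψ : grAlg p δ T ⟶ A}
    (h : ∀ g, φ.toAlgHom (gen p δ T g) = ψ.toAlgHom (gen p δ T g)) : φ = ψ :=
  GrAlg.Hom.ext (algHom_ext h)

end TruncAlg

/-! ### Representability of `G_p^{[k]}` -/

/-- Generators of the algebra representing `G_p^{[k]}`: `xi n` stands for the coefficient of
`X^(p^(n+1))` and `tau _` for the `ε`-component of the leading coefficient. -/
inductive BrGen (p k : ℕ) : Type u
  | xi (n : ℕ) : BrGen p k
  | tau (h : EpsAllowed p k 0) : BrGen p k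

/-- The degrees of the generators. -/
def BrGen.deg {p k : ℕ} : BrGen.{u} p k → ℤ
  | xi n => coeffDeg p k (n + 1)
  | tau _ => 1

/-- The graded commutative algebra that represents `G_p^{[k]}`. -/
noncomputable abbrev brAlg (p k : ℕ) : GrAlg.{u} p :=
  TruncAlg.grAlg p (BrGen.deg (p := p) (k := k)) (Set.range BrGen.xi)

/-- The generators as elements of `brAlg p k`. -/
noncomputable abbrev brGen (p k : ℕ) (g : BrGen.{u} p k) : brAlg.{u} p k :=
  TruncAlg.gen p BrGen.deg (Set.range BrGen.xi) g

lemma BrGen.not_epsAllowed {p k i : ℕ} : ¬ EpsAllowed p (k + 1) (i + 1) := by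
  rintro ⟨_, h | ⟨_, h⟩⟩ <;> omega

variable {p : ℕ} [Fact p.Prime]

/-- From `ρ_1` on, the leading coefficient is replaced by `1`, so the kernel leaves it free. The
target `G_p^⟨k+2⟩` admits no `ε`, so only the `ε`-free parts have to be compared. -/
lemma mem_ker_rho_iff {k : ℕ} {A : GrAlg.{u} p} (α : Elem p (k + 1) A) :
    α ∈ (SubgroupFunctor.ker (rho p (k + 1))).obj A ↔ ∀ i, (α.c (i + 1)).re ^ p = 0 := by
  have h0 : α ∈ (SubgroupFunctor.ker (rho p (k + 1))).obj A ↔ Elem.rho (k + 1) A α = 1 := Iff.rfl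
  rw [h0]
  constructor
  · intro h i
    have h1 := Elem.c_rho α (i + 1)
    rw [h, Elem.c_one, if_neg (by omega), if_neg (by omega)] at h1
    rw [← Eps.re_pow, ← h1]
    rfl
  · intro h
    refine Elem.ext (fun i => ?_) (fun i hi => ?_)
    · rw [Elem.c_rho, Elem.c_one]
      cases i with
      | zero => simp
      | succ i => simp [h i]
    · obtain ⟨_, h | ⟨h, _⟩⟩ := hi <;> omega

open Classical in
/-- The coefficients of the universal element of `G_p^{[k]}`. -/
noncomputable def brCoeff (p k : ℕ) : ℕ → Eps (brAlg.{u} p k)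
  | 0 => ⟨1, if h : EpsAllowed p k 0 then brGen p k (.tau h) else 0⟩
  | n + 1 => ⟨brGen p k (.xi n), 0⟩

/-- The universal element of `G_p^{[k]}`. -/
noncomputable def brElem (p k : ℕ) [Fact p.Prime] : Elem p (k + 1) (brAlg.{u} p (k + 1)) :=
  Elem.mkSeq (brCoeff p (k + 1))
    (fun i => by
      have h0 : coeffDeg p (k + 1) 0 = 0 := by simp [coeffDeg]
      cases i with
      | zero =>
        rw [h0, brCoeff]
        refine ⟨SetLike.one_mem_graded (brAlg.{u} p (k + 1)).deg, ?_⟩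
        simp only
        split_ifs with h
        · exact TruncAlg.gen_mem (BrGen.tau h)
        · exact Submodule.zero_mem _
      | succ n => exact ⟨TruncAlg.gen_mem (BrGen.xi n), Submodule.zero_mem _⟩)
    rfl
    (fun i hi => by
      cases i with
      | zero => exact dif_neg hi
      | succ n => rfl)

lemma c_brElem (k i : ℕ) : (brElem.{u} p k).c i = brCoeff p (k + 1) i := Elem.c_mkSeq _ _ _ _ i

lemma brElem_mem (k : ℕ) :
    brElem.{u} p k ∈ (SubgroupFunctor.ker (rho p (k + 1))).obj (brAlg.{u} p (k + 1)) := by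
  rw [mem_ker_rho_iff]
  intro i
  rw [c_brElem]
  exact TruncAlg.gen_pow _ ⟨i, rfl⟩

/-- A homomorphism out of the representing algebra is a choice of values for the generators, and
these are exactly the free coefficients of `α`; the truncation relations are the kernel condition.
-/
lemma existsUnique_map_brElem {k : ℕ} {A : GrAlg.{u} p} (α : Elem p (k + 1) A)
    (hα : α ∈ (SubgroupFunctor.ker (rho p (k + 1))).obj A) :
    ∃! φ : brAlg.{u} p (k + 1) ⟶ A, Elem.map φ (brElem p k) = α := by
  rw [mem_ker_rho_iff] at hα
  let f : BrGen.{u} p (k + 1) → A := fun g => match g with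
    | .xi n => (α.c (n + 1)).re
    | .tau _ => (α.c 0).im
  obtain ⟨φ, hφ⟩ := TruncAlg.exists_hom (δ := BrGen.deg) (T := Set.range BrGen.xi) f
    (by
      rintro (n | h)
      · exact (α.deg (n + 1)).1
      · simpa [coeffDeg, f, BrGen.deg] using (α.deg 0).2)
    (by
      rintro _ ⟨n, rfl⟩
      exact hα n)
  refine ⟨φ, ?_, fun ψ hψ => TruncAlg.hom_ext fun g => ?_⟩
  · refine Elem.ext (fun i => ?_) (fun i hi => ?_) <;> rw [Elem.c_map, c_brElem]
    · cases i with
      | zero => exact (map_one φ.toAlgHom).trans α.re_zero.symm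
      | succ n => exact hφ (.xi n)
    · cases i with
      | zero =>
        rw [brCoeff, Eps.im_map]
        simp only [dif_pos hi]
        exact hφ (.tau hi)
      | succ n => exact absurd hi BrGen.not_epsAllowed
  · rw [hφ g]
    have hc : ∀ i, Eps.map ψ (brCoeff p (k + 1) i) = α.c i := fun i => by
      rw [← c_brElem, ← Elem.c_map, hψ]
    rcases g with n | h
    · exact congrArg Eps.re (hc (n + 1))
    · have h1 := congrArg Eps.im (hc 0)
      rw [brCoeff, Eps.im_map] at h1
      simpa only [dif_pos h] using h1

theorem isCorepresentable_Gbr (k : ℕ) :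
    (Gbr.{u} p (k + 1) ⋙ forget GrpCat.{u}).IsCorepresentable := by
  let F := Gbr.{u} p (k + 1) ⋙ forget GrpCat.{u}
  let χ : F.obj (brAlg.{u} p (k + 1)) := (⟨brElem p k, brElem_mem k⟩ :
    (SubgroupFunctor.ker (rho.{u} p (k + 1))).obj (brAlg.{u} p (k + 1)))
  -- By Yoneda, evaluation at the universal element `χ` has to be bijective.
  have hb : ∀ A : GrAlg.{u} p, Function.Bijective
      fun φ : brAlg.{u} p (k + 1) ⟶ A => F.map φ χ := fun A => by
    rw [Function.bijective_iff_existsUnique]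
    rintro ⟨α, hα⟩
    obtain ⟨φ, h1, h2⟩ := existsUnique_map_brElem α hα
    exact ⟨φ, Subtype.ext h1, fun ψ hψ => h2 ψ (congrArg Subtype.val hψ)⟩
  exact (⟨Equiv.ofBijective _ (hb _), fun g f => by simp⟩ : F.CorepresentableBy (brAlg.{u} p (k + 1))).isCorepresentable

end Truncated

/-! ### Adjoining roots: a faithfully flat extension -/

section Roots

/-- Centrality of such elements is what allows `x_i^N` to be replaced by `q_i` although `A` is only
graded commutative. -/
lemma GrAlg.mem_center_of_dvd {p : ℕ} (A : GrAlg.{u} p) {i : ℤ} {a : A} (h : GrAlg.unitDeg p ∣ i)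
    (ha : a ∈ A.deg i) : a ∈ Subring.center A := by
  refine Subring.mem_center_iff.2 fun b => ?_
  refine Decomposition.inductionOn A.deg (by simp) (fun {j} m => ?_) (fun m n h1 h2 => ?_) b
  · exact (A.commute_of_dvd h ha m.2).symm
  · rw [add_mul, mul_add, h1, h2]

/-- The data for adjoining `N`-th roots: elements `q i` of `A` of degree `N * w i`. -/
structure RootData {p : ℕ} (A : GrAlg.{u} p) where
  N : ℕ
  pos : 0 < N
  w : ℕ → ℤ
  dvd : ∀ i, GrAlg.unitDeg p ∣ w i
  q : ℕ → A
  mem : ∀ i, q i ∈ A.deg (N * w i)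

namespace RootData

variable {p : ℕ} {A : GrAlg.{u} p} (D : RootData A)

/-- The exponents of a monomial reduced modulo `N`. -/
noncomputable def red (e : ℕ →₀ ℕ) : ℕ →₀ ℕ := e.mapRange (· % D.N) (Nat.zero_mod _)

/-- The exponents of a monomial divided by `N`. -/
noncomputable def quo (e : ℕ →₀ ℕ) : ℕ →₀ ℕ := e.mapRange (· / D.N) (Nat.zero_div _)

lemma red_red_add (e f : ℕ →₀ ℕ) : D.red (D.red e + D.red f) = D.red (e + f) := by
  ext i
  simp [red]

/-- Addition with carry in each exponent: the last summand is the carry produced by the two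
remainders. -/
lemma quo_add (e f : ℕ →₀ ℕ) : D.quo (e + f) = D.quo e + D.quo f + D.quo (D.red e + D.red f) := by
  ext i
  simp only [quo, red, Finsupp.mapRange_apply, Finsupp.add_apply]
  conv_lhs => rw [← Nat.div_add_mod (e i) D.N, ← Nat.div_add_mod (f i) D.N,
    add_add_add_comm, ← mul_add, Nat.mul_add_div D.pos]

lemma quo_add_red (e : ℕ →₀ ℕ) : D.N • D.quo e + D.red e = e := by
  ext i
  simp [quo, red, Nat.div_add_mod]

@[simp] lemma red_zero : D.red 0 = 0 := Finsupp.mapRange_zero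
@[simp] lemma quo_zero : D.quo 0 = 0 := Finsupp.mapRange_zero

/-- The degree of a monomial. -/
noncomputable def wt : (ℕ →₀ ℕ) →+ ℤ :=
  Finsupp.liftAddHom fun i => (AddMonoidHom.mulRight (D.w i)).comp (Nat.castAddMonoidHom ℤ)

@[simp] lemma wt_single (i m : ℕ) : D.wt (Finsupp.single i m) = m * D.w i := by
  simp [wt]

lemma dvd_wt (e : ℕ →₀ ℕ) : GrAlg.unitDeg p ∣ D.wt e := by
  induction e using Finsupp.induction_linear with
  | zero => simp
  | add e f he hf => rw [map_add]; exact dvd_add he hf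
  | single i m => rw [wt_single]; exact (D.dvd i).mul_left _

/-- Used to see that reduction is homogeneous: the degree `N * wt (quo e)` lost by the monomial is
that of the coefficient `val (quo e)` gained. -/
lemma wt_eq (e : ℕ →₀ ℕ) : D.wt e = D.N * D.wt (D.quo e) + D.wt (D.red e) := by
  conv_lhs => rw [← D.quo_add_red e, map_add, map_nsmul, nsmul_eq_mul]

/-- The elements `q i` as elements of the center. -/
def central (i : ℕ) : Subring.center A :=
  ⟨D.q i, A.mem_center_of_dvd ((D.dvd i).mul_left _) (D.mem i)⟩

/-- The value of a monomial at the `q i`. -/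
noncomputable def val (e : ℕ →₀ ℕ) : A :=
  (e.prod fun i m => D.central i ^ m : Subring.center A)

lemma val_comm (e : ℕ →₀ ℕ) (a : A) : D.val e * a = a * D.val e :=
  (Subring.mem_center_iff.1 (Subtype.property _) a).symm

@[simp] lemma val_zero : D.val 0 = 1 := by simp [val]

lemma val_add (e f : ℕ →₀ ℕ) : D.val (e + f) = D.val e * D.val f := by
  rw [val, Finsupp.prod_add_index' (fun _ => pow_zero _) (fun _ _ _ => pow_add _ _ _)]
  rfl

@[simp] lemma val_single (i : ℕ) : D.val (Finsupp.single i 1) = D.q i := by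
  rw [val, Finsupp.prod_single_index (h := fun i m => D.central i ^ m) (pow_zero _), pow_one]
  rfl

lemma val_mem (e : ℕ →₀ ℕ) : D.val e ∈ A.deg (D.N * D.wt e) := by
  induction e using Finsupp.induction_linear with
  | zero => simpa using SetLike.one_mem_graded A.deg
  | add e f he hf =>
    rw [val_add, map_add, mul_add]
    exact SetLike.mul_mem_graded he hf
  | single i m =>
    rw [val, Finsupp.prod_single_index (h := fun i m => D.central i ^ m) (pow_zero _), wt_single]
    have h := SetLike.pow_mem_graded m (D.mem i)
    rw [nsmul_eq_mul, mul_left_comm] at h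
    simpa [central] using h

/-- The polynomials over `A` in commuting variables `x i`. -/
abbrev Poly (A : GrAlg.{u} p) : Type u := AddMonoidAlgebra A (ℕ →₀ ℕ)

open AddMonoidAlgebra (single)

/-- Reduction of polynomials by means of `x i ^ N = q i`. -/
noncomputable def reduce : Poly A →+ Poly A :=
  AddMonoidAlgebra.liftNC (AddMonoidAlgebra.singleAddHom 0)
    fun e => single (D.red e.toAdd) (D.val (D.quo e.toAdd))

@[simp] lemma reduce_single (e : ℕ →₀ ℕ) (a : A) :
    D.reduce (single e a) = single (D.red e) (a * D.val (D.quo e)) := by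
  rw [reduce, AddMonoidAlgebra.liftNC_single]
  simp [AddMonoidAlgebra.single_mul_single]

/-- Reducing the factors first does not change the reduced product: the remainders multiply with a
carry (`quo_add`), and the values of the `q i` are central. This makes reduced polynomials a ring
with `cls` multiplicative, so that the ring axioms are inherited from polynomials, while the module
basis of reduced monomials stays visible. -/
lemma reduce_mul (x y : Poly A) : D.reduce (D.reduce x * D.reduce y) = D.reduce (x * y) := by
  induction x using AddMonoidAlgebra.induction_linear with
  | zero => simp
  | add x x' h h' => simp only [map_add, add_mul, h, h']
  | single e a =>
    induction y using AddMonoidAlgebra.induction_linear with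
    | zero => simp
    | add x x' h h' => simp only [map_add, mul_add, h, h']
    | single f b =>
      simp only [reduce_single, AddMonoidAlgebra.single_mul_single, red_red_add]
      rw [D.quo_add e f, val_add, val_add]
      congr 1
      -- The value coming from the first monomial is moved past the coefficient `b`.
      rw [mul_assoc a, ← mul_assoc _ b, D.val_comm]
      simp only [mul_assoc]

lemma reduce_one : D.reduce 1 = 1 := by
  rw [AddMonoidAlgebra.one_def, reduce_single]
  simp

lemma reduce_reduce (x : Poly A) : D.reduce (D.reduce x) = D.reduce x := by
  have h := D.reduce_mul x 1
  rwa [reduce_one, mul_one, mul_one] at h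

lemma reduce_smul (r : ZMod p) (x : Poly A) : D.reduce (r • x) = r • D.reduce x := by
  induction x using AddMonoidAlgebra.induction_linear with
  | zero => simp
  | add x x' h h' => simp only [map_add, smul_add, h, h']
  | single e a => simp

/-- The reduced polynomials. -/
noncomputable def reduced : Submodule (ZMod p) (Poly A) where
  carrier := {x | D.reduce x = x}
  add_mem' {x y} hx hy := by simpa using congrArg₂ (· + ·) hx hy
  zero_mem' := map_zero _
  smul_mem' r x hx := (D.reduce_smul r x).trans (congrArg _ hx)

/-- The algebra `A[x_0, x_1, …]/(x_i^N - q_i)`, realized by reduced polynomials. -/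
def Ext : Type u := D.reduced

noncomputable instance : AddCommGroup D.Ext := inferInstanceAs (AddCommGroup D.reduced)
noncomputable instance : Module (ZMod p) D.Ext := inferInstanceAs (Module (ZMod p) D.reduced)

/-- The inclusion of the reduced polynomials. -/
noncomputable def incl : D.Ext →ₗ[ZMod p] Poly A := D.reduced.subtype

lemma incl_injective : Function.Injective D.incl := Subtype.val_injective

@[simp] lemma reduce_incl (x : D.Ext) : D.reduce (D.incl x) = D.incl x := x.2

/-- The class of a polynomial. -/
noncomputable def cls : Poly A →ₗ[ZMod p] D.Ext where
  toFun x := (⟨D.reduce x, D.reduce_reduce x⟩ : D.reduced)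
  map_add' x y := Subtype.ext (map_add D.reduce x y)
  map_smul' r x := Subtype.ext (D.reduce_smul r x)

@[simp] lemma incl_cls (x : Poly A) : D.incl (D.cls x) = D.reduce x := rfl

@[simp] lemma cls_incl (x : D.Ext) : D.cls (D.incl x) = x := D.incl_injective (D.reduce_incl x)

@[simp] lemma cls_reduce (x : Poly A) : D.cls (D.reduce x) = D.cls x :=
  D.incl_injective (D.reduce_reduce x)

noncomputable instance : Mul D.Ext := ⟨fun x y => D.cls (D.incl x * D.incl y)⟩
noncomputable instance : One D.Ext := ⟨D.cls 1⟩

lemma one_def : (1 : D.Ext) = D.cls 1 := rfl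

lemma cls_mul (x y : Poly A) : D.cls (x * y) = D.cls x * D.cls y :=
  D.incl_injective (D.reduce_mul x y).symm

lemma ext_induction {P : D.Ext → Prop} (h : ∀ x, P (D.cls x)) (x : D.Ext) : P x := by
  rw [← D.cls_incl x]
  exact h _

noncomputable instance : Ring D.Ext :=
  { (inferInstance : AddCommGroup D.Ext) with
    mul_assoc := fun x y z => by
      induction x using ext_induction
      induction y using ext_induction
      induction z using ext_induction
      simp only [← cls_mul, mul_assoc]
    one_mul := fun x => by
      induction x using ext_induction
      rw [one_def, ← cls_mul, one_mul]
    mul_one := fun x => by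
      induction x using ext_induction
      rw [one_def, ← cls_mul, mul_one]
    zero_mul := fun x => by
      induction x using ext_induction
      rw [← map_zero D.cls, ← cls_mul, zero_mul]
    mul_zero := fun x => by
      induction x using ext_induction
      rw [← map_zero D.cls, ← cls_mul, mul_zero]
    left_distrib := fun x y z => by
      induction x using ext_induction
      induction y using ext_induction
      induction z using ext_induction
      rw [← map_add, ← cls_mul, ← cls_mul, ← cls_mul, ← map_add, mul_add]
    right_distrib := fun x y z => by
      induction x using ext_induction
      induction y using ext_induction
      induction z using ext_induction
      rw [← map_add, ← cls_mul, ← cls_mul, ← cls_mul, ← map_add, add_mul] }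

noncomputable instance : Algebra (ZMod p) D.Ext :=
  Algebra.ofModule
    (fun r x y => by
      induction x using ext_induction
      induction y using ext_induction
      rw [← map_smul, ← cls_mul, ← cls_mul, ← map_smul, smul_mul_assoc])
    (fun r x y => by
      induction x using ext_induction
      induction y using ext_induction
      rw [← map_smul, ← cls_mul, ← cls_mul, ← map_smul, mul_smul_comm])

lemma cls_single_mul (e f : ℕ →₀ ℕ) (a b : A) :
    D.cls (single e a) * D.cls (single f b) = D.cls (single (e + f) (a * b)) := by
  rw [← cls_mul, AddMonoidAlgebra.single_mul_single]

/-- The homogeneous elements of degree `n` of `A[x_0, x_1, …]/(x_i^N - q_i)`. -/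
def deg (n : ℤ) : Submodule (ZMod p) D.Ext where
  carrier := {x | ∀ e, (D.incl x).coeff e ∈ A.deg (n - D.wt e)}
  add_mem' {x y} hx hy e := by simpa using Submodule.add_mem _ (hx e) (hy e)
  zero_mem' e := by simp
  smul_mem' r x hx e := by simpa using Submodule.smul_mem _ r (hx e)

/-- The monomial need not be reduced: by `wt_eq`, reduction shifts degree from the monomial to the
coefficient and preserves the total. -/
lemma cls_single_mem {n i : ℤ} {e : ℕ →₀ ℕ} {a : A} (ha : a ∈ A.deg i) (h : i + D.wt e = n) :
    D.cls (single e a) ∈ D.deg n := by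
  intro f
  rw [incl_cls, reduce_single, AddMonoidAlgebra.coeff_single, Finsupp.single_apply]
  split_ifs with hf
  · have h1 := SetLike.mul_mem_graded ha (D.val_mem (D.quo e))
    have h2 := D.wt_eq e
    rwa [show i + D.N * D.wt (D.quo e) = n - D.wt f by rw [← hf]; omega] at h1
  · exact Submodule.zero_mem _

lemma deg_induction {n : ℤ} {P : D.Ext → Prop} (zero : P 0) (add : ∀ x y, P x → P y → P (x + y))
    (single : ∀ i e a, a ∈ A.deg i → i + D.wt e = n → P (D.cls (single e a)))
    {x : D.Ext} (hx : x ∈ D.deg n) : P x := by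
  rw [← D.cls_incl x, ← AddMonoidAlgebra.sum_coeff_single (D.incl x), Finsupp.sum, map_sum]
  exact Finset.sum_induction _ P add zero fun e _ => single _ e _ (hx e) (sub_add_cancel _ _)

instance : SetLike.GradedMonoid D.deg where
  one_mem := D.cls_single_mem (e := 0) (SetLike.one_mem_graded A.deg) (by simp)
  mul_mem i j x y hx hy := by
    refine D.deg_induction (P := fun x => x * y ∈ D.deg (i + j)) ?_ (fun x x' h h' => ?_)
      (fun k e a ha hk => ?_) hx
    · rw [zero_mul]; exact Submodule.zero_mem _
    · rw [add_mul]; exact Submodule.add_mem _ h h'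
    · refine D.deg_induction (P := fun y => _ * y ∈ D.deg (i + j)) ?_ (fun x x' h h' => ?_)
        (fun l f b hb hl => ?_) hy
      · rw [mul_zero]; exact Submodule.zero_mem _
      · rw [mul_add]; exact Submodule.add_mem _ h h'
      · rw [cls_single_mul]
        exact D.cls_single_mem (SetLike.mul_mem_graded ha hb) (by rw [map_add]; omega)

lemma deg_comm {i j : ℤ} {x y : D.Ext} (hx : x ∈ D.deg i) (hy : y ∈ D.deg j) :
    x * y = (i * j).negOnePow • (y * x) := by
  refine D.deg_induction (P := fun x => x * y = (i * j).negOnePow • (y * x)) ?_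
    (fun x x' h h' => ?_) (fun k e a ha hk => ?_) hx
  · rw [zero_mul, mul_zero, smul_zero]
  · rw [add_mul, h, h', mul_add, smul_add]
  · refine D.deg_induction (P := fun y => _ * y = (i * j).negOnePow • (y * _)) ?_
      (fun x x' h h' => ?_) (fun l f b hb hl => ?_) hy
    · rw [zero_mul, mul_zero, smul_zero]
    · rw [mul_add, h, h', add_mul, smul_add]
    · subst hk hl
      -- Monomials in the `x i` have degree divisible by `d`, so only the product `k * l` of the
      -- degrees of the coefficients affects the sign.
      have h : (k + D.wt e) * (l + D.wt f) = k * l + ((k + D.wt e) * D.wt f + D.wt e * l) := by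
        ring
      have hd : GrAlg.unitDeg p ∣ (k + D.wt e) * D.wt f + D.wt e * l :=
        dvd_add ((D.dvd_wt f).mul_left _) ((D.dvd_wt e).mul_right _)
      rw [cls_single_mul, cls_single_mul, A.comm ha hb, add_comm f e, h, Int.negOnePow_add,
        mul_smul, GrAlg.negOnePow_smul hd]
      rcases Int.units_eq_one_or (k * l).negOnePow with h | h <;> rw [h]
      · rw [one_smul, one_smul]
      · rw [Units.neg_smul, one_smul, Units.neg_smul, one_smul, ← map_neg]
        congr 1
        exact map_neg (AddMonoidAlgebra.singleAddHom (e + f)) (b * a)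

/-- The homogeneous component of degree `n - |x^e|` of the coefficient of `x^e`. -/
noncomputable def comp (n : ℤ) (e : ℕ →₀ ℕ) : D.Ext →+ A where
  toFun x := decompose A.deg ((D.incl x).coeff e) (n - D.wt e)
  map_zero' := by simp
  map_add' x y := by simp

lemma comp_coe (n : ℤ) (e : ℕ →₀ ℕ) (v : ⨁ i, D.deg i) :
    D.comp n e (DirectSum.coeAddMonoidHom D.deg v) = (D.incl (v n)).coeff e := by
  induction v using DirectSum.induction_on with
  | zero => simp
  | of m x =>
    rw [DirectSum.coeAddMonoidHom_of]
    by_cases h : m = n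
    · subst h
      rw [DirectSum.of_eq_same]
      exact decompose_of_mem_same _ (x.2 e)
    · rw [DirectSum.of_eq_of_ne _ _ _ (Ne.symm h)]
      refine (decompose_of_mem_ne _ (x.2 e) fun h' => h ?_).trans ?_
      · omega
      · simp
  | add v v' h h' => rw [map_add, map_add, h, h']; simp

/-- The homogeneous parts are independent because `comp n e` recovers each coefficient of the
component of degree `n` from the sum. They span because the coefficient of a monomial can be split
into its homogeneous components. -/
lemma isInternal_deg : DirectSum.IsInternal D.deg := by
  constructor
  · refine (injective_iff_map_eq_zero _).2 fun v hv => ?_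
    refine DFinsupp.ext fun n => Subtype.ext (D.incl_injective ?_)
    ext e
    have h := D.comp_coe n e v
    rw [hv, map_zero] at h
    rw [← h]
    simp
  · intro x
    rw [← AddMonoidHom.mem_mrange]
    induction x using ext_induction with
    | h x =>
      induction x using AddMonoidAlgebra.induction_linear with
      | zero => rw [map_zero]; exact AddSubmonoid.zero_mem _
      | add x y hx hy => rw [map_add]; exact AddSubmonoid.add_mem _ hx hy
      | single e a =>
        refine Decomposition.inductionOn A.deg ?_ (fun {i} m => ?_) (fun a b ha hb => ?_) a
        · simp
        · exact ⟨DirectSum.of (fun i => D.deg i) _ ⟨_, D.cls_single_mem m.2 rfl⟩,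
            DirectSum.coeAddMonoidHom_of _ _ _⟩
        · rw [AddMonoidAlgebra.single_add, map_add]
          exact AddSubmonoid.add_mem _ ha hb

noncomputable instance : GradedAlgebra D.deg :=
  { (inferInstance : SetLike.GradedMonoid D.deg), D.isInternal_deg.chooseDecomposition with }

/-- The graded commutative algebra `A[x_0, x_1, …]/(x_i^N - q_i)`. -/
noncomputable def ext : GrAlg.{u} p where
  carrier := D.Ext
  deg := D.deg
  comm := D.deg_comm

/-- The structure homomorphism `A → A[x_0, x_1, …]/(x_i^N - q_i)`. -/
noncomputable def ofBase : A ⟶ D.ext where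
  toAlgHom := AlgHom.ofLinearMap (B := D.Ext)
    { toFun a := D.cls (single 0 a)
      map_add' a b := by rw [AddMonoidAlgebra.single_add, map_add]
      map_smul' r a := by rw [← AddMonoidAlgebra.smul_single, map_smul]; rfl }
    rfl
    (fun a b => by
      simp only [LinearMap.coe_mk, AddHom.coe_mk]
      rw [cls_single_mul, add_zero])
  map_deg ha := D.cls_single_mem ha (by simp)

lemma ofBase_apply (a : A) : D.ofBase.toAlgHom a = D.cls (single 0 a) := rfl

/-- The class of a monomial. -/
noncomputable def monomial (e : ℕ →₀ ℕ) : D.ext := D.cls (single e 1)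

/-- The class of the variable `x i`. -/
noncomputable def root (i : ℕ) : D.ext := D.monomial (Finsupp.single i 1)

lemma root_mem (i : ℕ) : D.root i ∈ D.ext.deg (D.w i) :=
  D.cls_single_mem (SetLike.one_mem_graded A.deg) (by simp)

lemma root_pow (i : ℕ) : D.root i ^ D.N = D.ofBase.toAlgHom (D.q i) := by
  have h : ∀ m : ℕ, D.root i ^ m = D.cls (single (Finsupp.single i m) 1) := by
    intro m
    induction m with
    | zero => rw [Finsupp.single_zero]; exact pow_zero _
    | succ m ih =>
      rw [pow_succ, ih]
      refine (D.cls_single_mul _ _ _ _).trans ?_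
      rw [← Finsupp.single_add, mul_one]
  rw [h, ofBase_apply, ← cls_reduce, reduce_single]
  have h1 : D.red (Finsupp.single i D.N) = 0 := by simp [red]
  have h2 : D.quo (Finsupp.single i D.N) = Finsupp.single i 1 := by
    simp [quo, Nat.div_self D.pos]
  rw [h1, h2, val_single, one_mul]

/-- Reduction multiplies coefficients by elements of `A` on the right, so it commutes with left
multiplication by `a`. Linear relations over `A` can thus be read off coefficient by coefficient. -/
lemma coeff_ofBase_mul (a : A) (x : D.Ext) (e : ℕ →₀ ℕ) :
    (D.incl (D.cls (single 0 a) * x)).coeff e = a * (D.incl x).coeff e := by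
  have h : ∀ y : Poly A, D.reduce (single 0 a * y) = single 0 a * D.reduce y := fun y => by
    induction y using AddMonoidAlgebra.induction_linear with
    | zero => simp
    | add x x' h h' => simp only [map_add, mul_add, h, h']
    | single f b =>
      simp only [reduce_single, AddMonoidAlgebra.single_mul_single, zero_add, mul_assoc]
  conv_lhs => rw [← D.cls_incl x, ← cls_mul, incl_cls, h, reduce_incl]
  exact AddMonoidAlgebra.coeff_single_mul_eq_mul_coeff _ (by simp)

/-- The extension is free as a left `A`-module on the reduced monomials. For flatness the `b i` are
expanded in the finitely many monomials that occur in them, and the relation holds for each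
coefficient. For faithfulness the coefficients of the monomial `1` are compared. -/
lemma faithfullyFlat_ofBase : FaithfullyFlat D.ofBase where
  flat n a b h := by
    classical
    let s : Finset (ℕ →₀ ℕ) := Finset.univ.biUnion fun i => (D.incl (b i)).coeff.support
    refine ⟨s.card, fun i j => (D.incl (b i)).coeff (s.equivFin.symm j : ℕ →₀ ℕ),
      fun j => D.monomial (s.equivFin.symm j), fun i => ?_, fun j => ?_⟩
    · rw [Equiv.sum_comp s.equivFin.symm fun e : s => D.ofBase.toAlgHom ((D.incl (b i)).coeff e) *
        D.monomial e, Finset.sum_coe_sort s fun e : ℕ →₀ ℕ =>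
        D.ofBase.toAlgHom ((D.incl (b i)).coeff e) * D.monomial e]
      have h1 : ∀ e : ℕ →₀ ℕ, D.ofBase.toAlgHom ((D.incl (b i)).coeff e) *
          D.monomial e =
          D.cls (single e ((D.incl (b i)).coeff e)) := fun e =>
        (D.cls_single_mul _ _ _ _).trans (by rw [zero_add, mul_one])
      rw [Finset.sum_congr rfl fun e _ => h1 e]
      refine (D.cls_incl (b i)).symm.trans ?_
      conv_lhs => rw [← AddMonoidAlgebra.sum_coeff_single (D.incl (b i))]
      rw [Finsupp.sum_of_support_subset (s := s) _
        (Finset.subset_biUnion_of_mem (fun i => (D.incl (b i)).coeff.support) (Finset.mem_univ i))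
        _ (by simp)]
      exact map_sum D.cls _ _
    · have h1 := congrArg (fun x : D.Ext => (D.incl x).coeff (s.equivFin.symm j : ℕ →₀ ℕ)) h
      refine Eq.trans ?_ h1
      refine Eq.trans ?_ (map_sum ((Finsupp.applyAddHom (s.equivFin.symm j : ℕ →₀ ℕ)).comp
        (AddMonoidAlgebra.coeffAddEquiv.toAddMonoidHom.comp D.incl.toAddMonoidHom)) _ _).symm
      exact Finset.sum_congr rfl fun i _ => (D.coeff_ofBase_mul _ _ _).symm
  faithful n a b h := by
    refine ⟨fun i => (D.incl (b i)).coeff 0, ?_⟩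
    have h1 := congrArg (fun x : D.Ext => (D.incl x).coeff 0) h
    have h2 : (D.incl (1 : D.Ext)).coeff 0 = 1 := by
      rw [one_def, incl_cls, reduce_one, AddMonoidAlgebra.coeff_one_zero]
    refine Eq.trans ?_ (h1.trans h2)
    refine Eq.trans ?_ (map_sum ((Finsupp.applyAddHom 0).comp
      (AddMonoidAlgebra.coeffAddEquiv.toAddMonoidHom.comp D.incl.toAddMonoidHom)) _ _).symm
    exact Finset.sum_congr rfl fun i _ => (D.coeff_ofBase_mul _ _ _).symm

end RootData

end Roots

/-! ### Lifting along the iterated Frobenius and the quotient maps -/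

variable {p : ℕ} [Fact p.Prime]

/-- The data for adjoining `p^(k+1)`-th roots of the coefficients of an element of `G_p^⟨k+1⟩(A)`. -/
noncomputable def Elem.rootData {k : ℕ} {A : GrAlg.{u} p} (α : Elem p (k + 1) A) : RootData A where
  N := p ^ (k + 1)
  pos := pow_pos (Fact.out : p.Prime).pos _
  w i := coeffDeg p 0 i
  dvd i := Elem.dvd_coeffDeg p 0 i
  q i := (α.c i).re
  mem i := by
    have h := (α.deg i).1
    rwa [show coeffDeg p (k + 1) i = (p ^ (k + 1) : ℕ) * coeffDeg p 0 i by
      simp only [coeffDeg]; push_cast; ring] at h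

lemma coeffDeg_zero_right (p k : ℕ) : coeffDeg p k 0 = 0 := by simp [coeffDeg]

/-- The lift takes the adjoined roots as its coefficients of index `i ≥ 1`. For `k ≠ 0` the
composite has leading coefficient `1`, so `α` must have it too: this is the role of `h0`. For `k =
0` the leading coefficient is kept and may be arbitrary. -/
lemma exists_lift_rhoIter {k : ℕ} {A : GrAlg.{u} p} (α : Elem p (k + 1) A)
    (h0 : k ≠ 0 → (α.c 0).im = 0) :
    ∃ (B : GrAlg.{u} p) (f : A ⟶ B), FaithfullyFlat f ∧
      ∃ β : Elem p 0 B, ((rhoIter p k).app B).hom β = Elem.map f α := by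
  let D := α.rootData
  let b : ℕ → Eps D.ext := fun i =>
    -- The leading coefficient is transported unchanged, so the adjoined root of index `0` plays no
    -- part. The other `ε`-parts can be anything, as the power kills them, and are taken to be `0`.
    if i = 0 then Eps.map D.ofBase (α.c 0) else ⟨D.root i, 0⟩
  have hdeg : ∀ i, (b i).HasDeg (coeffDeg p 0 i) := fun i => by
    simp only [b]
    split_ifs with h
    · subst h
      rw [coeffDeg_zero_right p 0, ← coeffDeg_zero_right p (k + 1)]
      exact ⟨D.ofBase.map_deg (α.deg 0).1, D.ofBase.map_deg (α.deg 0).2⟩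
    · exact ⟨D.root_mem i, Submodule.zero_mem _⟩
  have hlead : (b 0).re = 1 := (congrArg D.ofBase.toAlgHom α.re_zero).trans (map_one _)
  have heps : ∀ i, ¬ EpsAllowed p 0 i → (b i).im = 0 := fun i hi => by
    simp only [b]
    split_ifs with h
    · rw [Eps.im_map, Elem.c, α.2.eps 0 fun h' => hi ⟨h'.1, Or.inl rfl⟩, map_zero]
    · rfl
  let β : Elem p 0 D.ext := Elem.mkSeq b hdeg hlead heps
  have hβ : ∀ i, β.c i = b i := Elem.c_mkSeq b hdeg hlead heps
  refine ⟨D.ext, D.ofBase, D.faithfullyFlat_ofBase, β, ?_⟩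
  have hc : ∀ i, (if i = 0 then (if k = 0 then β.c 0 else 1) else β.c i ^ p ^ (k + 1)) =
      Eps.map D.ofBase (α.c i) := fun i => by
    split_ifs with hi hk
    · subst hi
      exact hβ 0
    · subst hi
      exact Eps.ext ((map_one _).symm.trans (congrArg D.ofBase.toAlgHom α.re_zero.symm))
        ((map_zero _).symm.trans (congrArg D.ofBase.toAlgHom (h0 hk).symm))
    · have hb : b i = ⟨D.root i, 0⟩ := if_neg hi
      refine Eps.ext ?_ ?_
      · rw [Eps.re_pow, hβ, hb]
        exact D.root_pow i
      · rw [Eps.im_pow_p (β.deg i) (Elem.dvd_coeffDeg p 0 i), Eps.im_map, Elem.c, α.2.eps i,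
          map_zero]
        -- In `G_p^⟨k+1⟩` only the leading coefficient may involve `ε`, and here `i ≠ 0`.
        rintro ⟨_, h | ⟨_, h⟩⟩ <;> omega
  have hc' : ∀ i, Elem.c (((rhoIter p k).app D.ext).hom β : Elem p (k + 1) D.ext) i =
      (Elem.map D.ofBase α).c i := fun i =>
    ((c_rhoIter k β i).trans (hc i)).trans (Elem.c_map D.ofBase α i).symm
  exact Elem.ext (fun i => congrArg Eps.re (hc' i)) (fun i _ => congrArg Eps.im (hc' i))

/-- The homomorphism `G̃_p^⟨k+1⟩ → G_p^{[k+1]}` induced by `ρ_k ∘ ⋯ ∘ ρ_0`. -/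
noncomputable def quotMap (p : ℕ) [Fact p.Prime] (k : ℕ) :
    (Gt.{u} p (k + 1)).toFunctor ⟶ Gbr.{u} p (k + 1) :=
  SubgroupFunctor.kerRestrict (rhoIter p k) (rho p (k + 1))

theorem isQuotientMap_quotMap (k : ℕ) :
    IsQuotientMap (Gt.{u} p (k + 1)) (Gt p k) (quotMap p k) where
  affine := isCorepresentable_Gbr k
  le := Gt_le k
  -- The restricted map is trivial on `h` exactly when `rhoIter p k` is, which is the definition of
  -- `Gt p k`.
  ker _ _ := Subtype.ext_iff
  surj A := by
    rintro ⟨α, hα⟩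
    -- For `k ≠ 0` the index `k + 1` is at least `2`, where no coefficient involves `ε`.
    obtain ⟨B, f, hf, β, hβ⟩ := exists_lift_rhoIter (α : Elem p (k + 1) A) fun hk =>
      (α : Elem p (k + 1) A).2.eps 0 fun h => by
        obtain ⟨_, h | ⟨h, _⟩⟩ := h <;> omega
    have hq := ((Gbr.{u} p (k + 1)).map f ⟨α, hα⟩).2
    refine ⟨B, f, hf, ⟨β, ?_⟩, Subtype.ext hβ⟩
    -- The lift lies in `Gt p (k + 1)` because its image under `rhoIter p k` is the image of `α` in
    -- `B`, which `ρ_(k+1)` kills.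
    exact (congrArg ((rho p (k + 1)).app B).hom hβ).trans hq

end Steenrod

theorem mainTheorem6 (p : ℕ) [Fact p.Prime] :
    (∀ k : ℕ, Steenrod.IsHopfIdeal p (Steenrod.idealJ.{u} p k)) ∧
    ∃ Gt : ℕ → Steenrod.SubgroupFunctor (Steenrod.G.{u} p 0),
      (∀ (k : ℕ) (A : Steenrod.GrAlg.{u} p),
        ((Gt k).obj A : Set ((Steenrod.G.{u} p 0).obj A)) =
          Steenrod.zeroLocus (Steenrod.idealJ.{u} p k) A) ∧
      (∀ k : ℕ, (Gt k).IsNormal) ∧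
      Gt 0 = Steenrod.Gab.{u} p ∧
      (∀ k : ℕ, Gt k ≤ Gt (k + 1)) ∧
      ∀ k : ℕ, ∃ π : (Gt (k + 1)).toFunctor ⟶ Steenrod.Gbr.{u} p (k + 1),
        Steenrod.IsQuotientMap (Gt (k + 1)) (Gt k) π :=
  ⟨Steenrod.isHopfIdeal_idealJ, Steenrod.Gt p, Steenrod.coe_Gt_obj,
    -- The equality `Gt 0 = Gab` is definitional: the composite for `k = 0` is `ρ_0` itself.
    fun k => Steenrod.SubgroupFunctor.isNormal_ker (Steenrod.rhoIter p k), rfl, Steenrod.Gt_le,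
    fun k => ⟨Steenrod.quotMap p k, Steenrod.isQuotientMap_quotMap k⟩⟩
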